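/- All vector spaces are real, and $0\le\ell\preceq k$ means $\ell\in\mathbb N$ with $\ell\le k$ (any $\ell\in\mathbb N$ if $k=\infty$). For Hausdorff locally convex spaces $H,F$, an open set $U\subseteq H$ and $k\in\mathbb N\sqcup\{\infty\}$, a map $f:U\to F$ is of class $C^k$ (in Bastiani's sense) if for all $0\le\ell\preceq k$ the iterated directional derivatives $\mathrm d^\ell f(x,v_1,\dots,v_\ell)=D_{v_\ell}(\cdots(D_{v_1}f)\cdots)(x)$ exist for all $x\in U$, $v_1,\dots,v_\ell\in H$ and define a continuous map $\mathrm d^\ell f:U\times H^\ell\to F$ (with $\mathrm d^0f=f$). Let $\Omega(H)$ be the set of pairs $(U,\breve U)$ with $U\subseteq H$ non-empty open and $U\subseteq\breve U\subseteq\overline U$. For $(U,\breve U)\in\Omega(H)$ let $\mathcal C^k_{\breve U}(U,F)$ be the vector space of all $f\in C^k(U,F)$ such that for each $0\le\ell\preceq k$ the differential $\mathrm d^\ell f$ extends to a (necessarily unique) continuous map $\mathrm{ext}(f,\ell):\breve U\times H^\ell\to F$. A subset $A$ of a non-empty open set $U\subseteq H$ is called harmonic if it is closed in $U$ and for all $x\in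 A$, $v\in H$ there are $\delta>0$ and a continuous $\gamma:[0,1]\to H$ with $\gamma(0)=0$ and $x+\gamma((0,1])+[0,\delta]\cdot v\subseteq U\setminus A$. Let $P,E,F$ be Hausdorff locally convex spaces, $H:=P\times E$, $(V,\breve V)\in\Omega(E)$, $0<\tau<1$, $k\in\mathbb N\sqcup\{\infty\}$, and let $\xi:P\to[0,\infty)$ be continuous such that (a) $\xi$ is of class $C^k$ on $P\setminus\{0\}$; (b) $\xi(Z)=0$ if and only if $Z=0$; (c) $\xi(\lambda Z)=\lambda\,\xi(Z)$ for all $\lambda\ge 0$ and $Z\in P$; (d) $\xi^{-1}(\{1\})$ is a harmonic subset of $P$. Put $B:=\xi^{-1}([0,1))$, $\breve B:=\xi^{-1}([0,1])$, $T:=\xi^{-1}([1+\tau,\infty))$. Then there is a linear map $$\mathcal E:\mathcal C^k_{\breve B\times\breve V}(B\times V,F)\to\mathcal C^k_{P\times\breve V}(P\times V,F)$$ such that for all $f\in\mathcal C^k_{\breve B\times\breve V}(B\times V,F)$ and $0\le\ell\preceq k$ $$\mathrm{ext}(\mathcal E(f),\ell)|_{\breve B\times\breve V\times H^\ell}=\mathrm{ext}(f,\ell)\qquad\text{and}\qquad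 \mathrm{ext}(\mathcal E(f),\ell)|_{T\times\breve V\times H^\ell}=0 .$$ Moreover, for every real pre-Hilbert space $P$ and every $k\in\mathbb N\sqcup\{\infty\}$, the norm $\xi=\|\cdot\|$ is continuous and satisfies (a)–(d), so the above applies to the unit ball of $P$. -/

import Mathlib

open Set Filter Topology

noncomputable section

namespace Bastiani

/-! Bastiani's differential calculus for maps between real topological vector spaces. -/

section Calculus

variable {H F : Type*} [AddCommGroup H] [Module ℝ H] [TopologicalSpace H]
  [AddCommGroup F] [Module ℝ F] [TopologicalSpace F]

/-- `y` is the directional derivative of `f` at `x` in direction `v`. -/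
def HasDirDerivAt (f : H → F) (y : F) (x v : H) : Prop :=
  Tendsto (fun t : ℝ => t⁻¹ • (f (x + t • v) - f x)) (𝓝[≠] 0) (𝓝 y)

/-- The directional derivative `D_v f (x)`, i.e. the limit of difference quotients
(meaningful where that limit exists). -/
def dirDeriv (f : H → F) (x v : H) : F :=
  limUnder (𝓝[≠] (0 : ℝ)) (fun t : ℝ => t⁻¹ • (f (x + t • v) - f x))

/-- The `ℓ`-th differential
`d^ℓ f (x, v₁, …, v_ℓ) = D_{v_ℓ} (D_{v_{ℓ-1}} (… (D_{v₁} f) …)) (x)`. -/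
def differential (f : H → F) : (ℓ : ℕ) → H → (Fin ℓ → H) → F
  | 0, x, _ => f x
  | ℓ + 1, x, w => dirDeriv (fun y => differential f ℓ y (Fin.init w)) x (w (Fin.last ℓ))

/-- `f` is of class `C^k` on the open set `U`: all iterated directional derivatives of order
at most `k` exist on `U`, and `d^ℓ f : U × H^ℓ → F` is continuous for all `ℓ ≤ k`.
The values of `f` outside `U` are irrelevant. -/
structure CkOn (k : ℕ∞) (f : H → F) (U : Set H) : Prop where
  exists_dirDeriv : ∀ ℓ : ℕ, ((ℓ + 1 : ℕ) : ℕ∞) ≤ k → ∀ (w : Fin ℓ → H) (v : H), ∀ x ∈ U,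
    ∃ y : F, HasDirDerivAt (fun z => differential f ℓ z w) y x v
  continuousOn : ∀ ℓ : ℕ, (ℓ : ℕ∞) ≤ k →
    ContinuousOn (fun p : H × (Fin ℓ → H) => differential f ℓ p.1 p.2) (U ×ˢ univ)

/-- The extension by zero of a map defined on `U`. It serves to apply the notions above to maps
that are only defined on an open set `U`. -/
def zeroExt {U : Set H} (f : U → F) : H → F := Function.extend Subtype.val f 0

/-- `Ψ : U' × H^ℓ → F` is a continuous extension of the `ℓ`-th differential of `f : U → F`
(here `U ⊆ U' ⊆ closure U`). -/
structure IsExtDifferential {U : Set H} (U' : Set H) (f : U → F) (ℓ : ℕ)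
    (Ψ : U' × (Fin ℓ → H) → F) : Prop where
  continuous : Continuous Ψ
  eq_differential : ∀ (x : H) (_ : x ∈ U) (hx' : x ∈ U') (w : Fin ℓ → H),
    Ψ (⟨x, hx'⟩, w) = differential (zeroExt f) ℓ x w

/-- Membership in `𝒞^k_{U'}(U, F)`: `f : U → F` is of class `C^k`, and for each `ℓ ≤ k` the
differential `d^ℓ f` extends to a continuous map `U' × H^ℓ → F`. -/
structure MemCkExt (k : ℕ∞) (U U' : Set H) (f : U → F) : Prop where
  ckOn : CkOn k (zeroExt f) U
  exists_ext : ∀ ℓ : ℕ, (ℓ : ℕ∞) ≤ k → ∃ Ψ, IsExtDifferential U' f ℓ Ψ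

/-- The class of pairs `(U, U')` with `U` non-empty open and `U ⊆ U' ⊆ closure U`. -/
structure IsPair (U U' : Set H) : Prop where
  nonempty : U.Nonempty
  isOpen : IsOpen U
  subset : U ⊆ U'
  subset_closure : U' ⊆ closure U

/-- `A ⊆ U` (with `U` open) is harmonic: `A` is closed in `U`, and for all `x ∈ A` and `v ∈ H`
there are `δ > 0` and a continuous path `γ : [0,1] → H` with `γ 0 = 0` and
`x + γ((0,1]) + [0,δ] • v ⊆ U \ A`. -/
structure IsHarmonic (U A : Set H) : Prop where
  subset : A ⊆ U
  isClosed : IsClosed ((↑) ⁻¹' A : Set U)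
  exists_path : ∀ x ∈ A, ∀ v : H, ∃ δ > (0 : ℝ), ∃ γ : ℝ → H,
    ContinuousOn γ (Icc 0 1) ∧ γ 0 = 0 ∧
      ∀ t ∈ Ioc (0 : ℝ) 1, ∀ s ∈ Icc (0 : ℝ) δ, x + γ t + s • v ∈ U \ A

/-- A distance-like function of class `C^k`. -/
structure IsDistanceLike (k : ℕ∞) (ξ : H → ℝ) : Prop where
  nonneg : ∀ Z, 0 ≤ ξ Z
  continuous : Continuous ξ
  ckOn : CkOn k ξ {0}ᶜ
  eq_zero_iff : ∀ Z, ξ Z = 0 ↔ Z = 0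
  homogeneous : ∀ c : ℝ, 0 ≤ c → ∀ Z, ξ (c • Z) = c * ξ Z
  harmonic : IsHarmonic univ (ξ ⁻¹' {1})

end Calculus

/-! The set `𝒞^k_{U'}(U, F)` is a linear space. -/

set_option linter.unusedSectionVars false

section Linear

variable {H F : Type*} [AddCommGroup H] [Module ℝ H]
  [AddCommGroup F] [Module ℝ F] [TopologicalSpace F]

theorem HasDirDerivAt.dirDeriv_eq [T2Space F] {f : H → F} {y : F} {x v : H}
    (h : HasDirDerivAt f y x v) : dirDeriv f x v = y :=
  Tendsto.limUnder_eq h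

theorem HasDirDerivAt.add_smul [ContinuousAdd F] [ContinuousSMul ℝ F] {f g : H → F} {y z : F}
    {x v : H} (c : ℝ) (hf : HasDirDerivAt f y x v) (hg : HasDirDerivAt g z x v) :
    HasDirDerivAt (f + c • g) (y + c • z) x v := by
  refine (Tendsto.add hf (Tendsto.const_smul hg c)).congr fun t => ?_
  simp only [Pi.add_apply, Pi.smul_apply, smul_sub, smul_add, smul_comm c t⁻¹]
  abel

theorem hasDirDerivAt_zero (x v : H) : HasDirDerivAt (fun _ : H => (0 : F)) 0 x v := by
  simp [HasDirDerivAt, tendsto_const_nhds]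

variable [TopologicalSpace H]

theorem HasDirDerivAt.congr [ContinuousAdd H] [ContinuousSMul ℝ H] {f g : H → F} {y : F}
    {x v : H} {U : Set H} (hU : IsOpen U) (hx : x ∈ U) (hfg : EqOn f g U)
    (h : HasDirDerivAt f y x v) : HasDirDerivAt g y x v := by
  have hc : Continuous (fun t : ℝ => x + t • v) := by fun_prop
  have hmem : ∀ᶠ t : ℝ in 𝓝[≠] 0, x + t • v ∈ U := by
    apply mem_nhdsWithin_of_mem_nhds
    apply hc.continuousAt.preimage_mem_nhds
    simpa using hU.mem_nhds hx
  refine Tendsto.congr' ?_ h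
  filter_upwards [hmem] with t ht
  rw [hfg ht, hfg hx]

theorem differential_add_smul [ContinuousAdd H] [ContinuousSMul ℝ H] [ContinuousAdd F]
    [ContinuousSMul ℝ F] [T2Space F] {k : ℕ∞} {U : Set H} (hU : IsOpen U) {f g : H → F} (c : ℝ)
    (hf : CkOn k f U) (hg : CkOn k g U) (ℓ : ℕ) (hℓ : (ℓ : ℕ∞) ≤ k) :
    ∀ (w : Fin ℓ → H), ∀ x ∈ U,
      differential (f + c • g) ℓ x w = differential f ℓ x w + c • differential g ℓ x w := by
  induction ℓ with
  | zero => intro w x _; rfl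
  | succ ℓ ih =>
    intro w x hx
    have ih' := ih (le_trans (by exact_mod_cast Nat.le_succ ℓ) hℓ) (Fin.init w)
    obtain ⟨y, hy⟩ := hf.exists_dirDeriv ℓ hℓ (Fin.init w) (w (Fin.last ℓ)) x hx
    obtain ⟨z, hz⟩ := hg.exists_dirDeriv ℓ hℓ (Fin.init w) (w (Fin.last ℓ)) x hx
    have h := (hy.add_smul c hz).congr hU hx (fun a ha => (ih' a ha).symm)
    simp only [differential]
    rw [h.dirDeriv_eq, hy.dirDeriv_eq, hz.dirDeriv_eq]

theorem CkOn.add_smul [ContinuousAdd H] [ContinuousSMul ℝ H] [ContinuousAdd F]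
    [ContinuousSMul ℝ F] [T2Space F] {k : ℕ∞} {U : Set H} (hU : IsOpen U) {f g : H → F} (c : ℝ)
    (hf : CkOn k f U) (hg : CkOn k g U) : CkOn k (f + c • g) U where
  exists_dirDeriv ℓ hℓ w v x hx := by
    obtain ⟨y, hy⟩ := hf.exists_dirDeriv ℓ hℓ w v x hx
    obtain ⟨z, hz⟩ := hg.exists_dirDeriv ℓ hℓ w v x hx
    exact ⟨_, (hy.add_smul c hz).congr hU hx fun a ha => (differential_add_smul hU c hf hg ℓ
      (le_trans (by exact_mod_cast Nat.le_succ ℓ) hℓ) w a ha).symm⟩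
  continuousOn ℓ hℓ := by
    refine ((hf.continuousOn ℓ hℓ).add ((hg.continuousOn ℓ hℓ).const_smul c)).congr ?_
    rintro ⟨x, w⟩ ⟨hx, -⟩
    exact differential_add_smul hU c hf hg ℓ hℓ w x hx

theorem zeroExt_add_smul {U : Set H} (f g : U → F) (c : ℝ) :
    zeroExt (f + c • g) = zeroExt f + c • zeroExt g := by
  funext x
  by_cases hx : x ∈ U
  · have h : ∀ e : U → F, zeroExt e x = e ⟨x, hx⟩ := fun e =>
      Subtype.val_injective.extend_apply e 0 ⟨x, hx⟩
    simp [h]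
  · have h : ∀ e : U → F, zeroExt e x = 0 := fun e =>
      Function.extend_apply' (f := Subtype.val) e 0 x (fun ⟨a, ha⟩ => hx (ha ▸ a.2))
    simp [h]

theorem zeroExt_zero {U : Set H} : zeroExt (0 : U → F) = 0 := by
  simpa using zeroExt_add_smul (0 : U → F) 0 (-1)

theorem differential_zero [T2Space F] (ℓ : ℕ) :
    ∀ (x : H) (w : Fin ℓ → H), differential (0 : H → F) ℓ x w = 0 := by
  induction ℓ with
  | zero => intro x w; rfl
  | succ ℓ ih =>
    intro x w
    simp only [differential, ih]
    exact (hasDirDerivAt_zero x _).dirDeriv_eq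

theorem MemCkExt.zero [T2Space F] (k : ℕ∞) (U U' : Set H) : MemCkExt k U U' (0 : U → F) where
  ckOn := by
    rw [zeroExt_zero]
    refine ⟨fun ℓ _ w v x _ => ⟨0, ?_⟩, fun ℓ _ => ?_⟩
    · simpa only [differential_zero] using hasDirDerivAt_zero x v
    · simpa only [differential_zero] using continuousOn_const
  exists_ext ℓ _ := ⟨fun _ => 0, continuous_const, fun x _ _ w => by
    rw [zeroExt_zero, differential_zero]⟩

theorem MemCkExt.add_smul [ContinuousAdd H] [ContinuousSMul ℝ H] [ContinuousAdd F]
    [ContinuousSMul ℝ F] [T2Space F] {k : ℕ∞} {U U' : Set H} (hU : IsOpen U) {f g : U → F} (c : ℝ)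
    (hf : MemCkExt k U U' f) (hg : MemCkExt k U U' g) : MemCkExt k U U' (f + c • g) where
  ckOn := by
    rw [zeroExt_add_smul]
    exact hf.ckOn.add_smul hU c hg.ckOn
  exists_ext ℓ hℓ := by
    obtain ⟨Φ, hΦ⟩ := hf.exists_ext ℓ hℓ
    obtain ⟨Ψ, hΨ⟩ := hg.exists_ext ℓ hℓ
    refine ⟨fun p => Φ p + c • Ψ p, hΦ.continuous.add (hΨ.continuous.const_smul c),
      fun x hx hx' w => ?_⟩
    rw [zeroExt_add_smul, differential_add_smul hU c hf.ckOn hg.ckOn ℓ hℓ w x hx,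
      hΦ.eq_differential x hx hx' w, hΨ.eq_differential x hx hx' w]

/-- The continuous extension of a differential is unique. -/
theorem IsExtDifferential.unique [T2Space F] {U U' : Set H} (h : U ⊆ U') (h' : U' ⊆ closure U)
    {f : U → F} {ℓ : ℕ} {Φ Ψ : U' × (Fin ℓ → H) → F} (hΦ : IsExtDifferential U' f ℓ Φ)
    (hΨ : IsExtDifferential U' f ℓ Ψ) : Φ = Ψ := by
  have hd : Dense ((↑) ⁻¹' U : Set U') := by
    intro x
    rw [closure_subtype, Subtype.image_preimage_coe, inter_eq_right.2 h]
    exact h' x.2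
  refine Continuous.ext_on (hd.prod dense_univ) hΦ.continuous hΨ.continuous ?_
  rintro ⟨⟨x, hx'⟩, w⟩ ⟨hx, -⟩
  rw [hΦ.eq_differential x hx hx' w, hΨ.eq_differential x hx hx' w]

/-- The real vector space `𝒞^k_{U'}(U, F)` of all `f : U → F` of class `C^k` whose differentials
of order at most `k` extend continuously to `U'`, for `U` open. -/
def CkExt [ContinuousAdd H] [ContinuousSMul ℝ H] [ContinuousAdd F] [ContinuousSMul ℝ F] [T2Space F]
    (k : ℕ∞) {U : Set H} (hU : IsOpen U) (U' : Set H) : Submodule ℝ (U → F) where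
  carrier := {f | MemCkExt k U U' f}
  zero_mem' := MemCkExt.zero k U U'
  add_mem' := fun {f g} hf hg => by
    have h := MemCkExt.add_smul hU 1 hf hg
    rwa [one_smul] at h
  smul_mem' := fun c f hf => by
    have h := MemCkExt.add_smul hU c (MemCkExt.zero k U U') hf
    rwa [zero_add] at h

/-- The continuous extension `U' × H^ℓ → F` of the `ℓ`-th differential of `f ∈ 𝒞^k_{U'}(U, F)`
for `ℓ ≤ k` (unique for `U ⊆ U' ⊆ closure U`). -/
def extDifferential [ContinuousAdd H] [ContinuousSMul ℝ H] [ContinuousAdd F] [ContinuousSMul ℝ F]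
    [T2Space F] {k : ℕ∞} {U : Set H} {hU : IsOpen U} {U' : Set H}
    (f : CkExt (F := F) k hU U') (ℓ : ℕ) (hℓ : (ℓ : ℕ∞) ≤ k) : U' × (Fin ℓ → H) → F :=
  Classical.choose (f.2.exists_ext ℓ hℓ)

theorem isExtDifferential_extDifferential [ContinuousAdd H] [ContinuousSMul ℝ H] [ContinuousAdd F]
    [ContinuousSMul ℝ F] [T2Space F] {k : ℕ∞} {U : Set H} {hU : IsOpen U} {U' : Set H}
    (f : CkExt (F := F) k hU U') (ℓ : ℕ) (hℓ : (ℓ : ℕ∞) ≤ k) :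
    IsExtDifferential U' (f : U → F) ℓ (extDifferential f ℓ hℓ) :=
  Classical.choose_spec (f.2.exists_ext ℓ hℓ)

end Linear

section DistanceLike

variable {P E : Type*} [AddCommGroup P] [Module ℝ P] [TopologicalSpace P] [TopologicalSpace E]

theorem IsDistanceLike.isOpen_prod {k : ℕ∞} {ξ : P → ℝ} (hξ : IsDistanceLike k ξ) {V : Set E}
    (hV : IsOpen V) : IsOpen ((ξ ⁻¹' Ico 0 1) ×ˢ V) := by
  have h : ξ ⁻¹' Ico 0 1 = ξ ⁻¹' Iio 1 := by
    ext Z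
    simp [hξ.nonneg Z]
  rw [h]
  exact (isOpen_Iio.preimage hξ.continuous).prod hV

end DistanceLike

end Bastiani

end

noncomputable section

universe u v w

namespace Bastiani

set_option linter.unusedSectionVars false

/-! ### Directional derivatives and the mean value theorem in locally convex spaces -/

section DirDeriv

variable {H F G : Type*} [AddCommGroup H] [Module ℝ H]
  [AddCommGroup F] [Module ℝ F] [TopologicalSpace F]
  [AddCommGroup G] [Module ℝ G] [TopologicalSpace G]

/-! The substitution `t = -log ξ(Z)` turns the shell around the sphere `ξ = 1` into a neighbourhood
of `t = 0`, with the ball on the side `t > 0`. There `polar` is `f(e^{-t} Z / ξ(Z), x)`, cut off to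
vanish for `t > c`; it is defined for `t ≥ 0` and `Z ≠ 0`. Seeley's formula continues it to `t < 0`
by `∑ a_j g(-2^j t, ·)`. Since `∑ a_j (-2^j)^p = 1` for every `p` (`exists_seeley_coeff`), all time
derivatives match at `t = 0`, with one sequence for all orders. For `t < 0` the sum is locally
finite because of the cutoff, so completeness of `F` is not needed; near `t = 0` it is controlled by
dominated convergence in each continuous seminorm. Substituting `t = -log ξ(Z)` back gives the
extension, which vanishes where `log ξ > c`.

Regularity is handled by induction on the order. The class `TCk` replaces the differentials by
iterated tangent maps, for which the chain rule is functorial (`TCk.comp`); `CkOn.tCk` and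
`TCk.exists_differential` translate to and from Bastiani's definition, including the extensions to
the boundary. Seeley's operator acts in the time variable only, so it is studied through partial
derivatives (`PCk.seeley`): a space derivative keeps the coefficients, a time derivative multiplies
the `j`-th one by `-2^j`, which merely shifts the moment index. Every passage from derivatives to
difference quotients rests on one mean value theorem, in which quotients lie in closed convex sets
containing the derivatives. -/

theorem HasDirDerivAt.clm_comp {f : H → F} {y : F} {x v : H} (L : F →L[ℝ] G)
    (h : HasDirDerivAt f y x v) : HasDirDerivAt (fun z => L (f z)) (L y) x v := by
  refine ((L.continuous.tendsto y).comp h).congr fun t => ?_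
  simp

theorem HasDirDerivAt.prodMk {f : H → F} {g : H → G} {y : F} {z : G} {x v : H}
    (hf : HasDirDerivAt f y x v) (hg : HasDirDerivAt g z x v) :
    HasDirDerivAt (fun a => (f a, g a)) (y, z) x v :=
  Tendsto.prodMk_nhds hf hg

theorem HasDirDerivAt.add [ContinuousAdd F] {f g : H → F} {y z : F} {x v : H}
    (hf : HasDirDerivAt f y x v) (hg : HasDirDerivAt g z x v) :
    HasDirDerivAt (fun a => f a + g a) (y + z) x v := by
  refine (Tendsto.add hf hg).congr fun t => ?_
  simp only [smul_sub, smul_add]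
  abel

theorem HasDirDerivAt.const_smul [ContinuousSMul ℝ F] {f : H → F} {y : F} {x v : H} (c : ℝ)
    (hf : HasDirDerivAt f y x v) : HasDirDerivAt (fun a => c • f a) (c • y) x v := by
  refine (Tendsto.const_smul hf c).congr fun t => ?_
  rw [← smul_sub, smul_comm]

theorem HasDirDerivAt.sum [ContinuousAdd F] {ι : Type*} (s : Finset ι) {f : ι → H → F}
    {y : ι → F} {x v : H} (hf : ∀ i ∈ s, HasDirDerivAt (f i) (y i) x v) :
    HasDirDerivAt (fun a => ∑ i ∈ s, f i a) (∑ i ∈ s, y i) x v := by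
  classical
  induction s using Finset.induction_on with
  | empty => simpa using hasDirDerivAt_zero x v
  | insert i s hi ih =>
    simp only [Finset.sum_insert hi]
    exact (hf i (Finset.mem_insert_self i s)).add
      (ih fun j hj => hf j (Finset.mem_insert_of_mem hj))

theorem hasDirDerivAt_const (c : F) (x v : H) : HasDirDerivAt (fun _ : H => c) 0 x v := by
  simp [HasDirDerivAt, tendsto_const_nhds]

theorem hasDirDerivAt_clm [TopologicalSpace H] (L : H →L[ℝ] F) (x v : H) :
    HasDirDerivAt L (L v) x v := by
  refine Tendsto.congr' ?_ tendsto_const_nhds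
  filter_upwards [self_mem_nhdsWithin] with t ht
  have ht : t ≠ 0 := ht
  simp [smul_smul, ht]

theorem tendsto_mul_nhdsNE_zero {c : ℝ} (hc : c ≠ 0) :
    Tendsto (fun t : ℝ => t * c) (𝓝[≠] 0) (𝓝[≠] 0) := by
  refine tendsto_nhdsWithin_iff.2 ⟨?_, ?_⟩
  · have : Tendsto (fun t : ℝ => t * c) (𝓝 0) (𝓝 (0 * c)) :=
      (continuous_id.mul continuous_const).tendsto 0
    rw [zero_mul] at this
    exact this.mono_left nhdsWithin_le_nhds
  · filter_upwards [self_mem_nhdsWithin] with t ht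
    exact mul_ne_zero ht hc

theorem HasDirDerivAt.smul_dir [ContinuousSMul ℝ F] {f : H → F} {y : F} {x v : H}
    (hf : HasDirDerivAt f y x v) (c : ℝ) : HasDirDerivAt f (c • y) x (c • v) := by
  rcases eq_or_ne c 0 with rfl | hc
  · simp [HasDirDerivAt, tendsto_const_nhds]
  refine ((hf.comp (tendsto_mul_nhdsNE_zero hc)).const_smul c).congr' ?_
  filter_upwards [self_mem_nhdsWithin] with t ht
  have ht : t ≠ 0 := ht
  simp only [Function.comp_apply, smul_smul]
  congr 1
  field_simp

/-- Derivative of `f` after an affine map. -/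
theorem HasDirDerivAt.comp_affine {K : Type*} [AddCommGroup K] [Module ℝ K] {f : H → F} {y : F}
    (a : K → H) (L : K → H) {x v : K} (ha : ∀ t : ℝ, a (x + t • v) = a x + t • L v)
    (hf : HasDirDerivAt f y (a x) (L v)) : HasDirDerivAt (fun z => f (a z)) y x v := by
  refine Tendsto.congr (fun t => ?_) hf
  simp only [ha]

theorem HasDirDerivAt.line {f : H → F} {y : F} {x v : H} {s : ℝ}
    (hf : HasDirDerivAt f y (x + s • v) v) : HasDirDerivAt (fun r : ℝ => f (x + r • v)) y s 1 :=
  HasDirDerivAt.comp_affine (fun r : ℝ => x + r • v) (fun r => r • v)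
    (fun t => by simp [_root_.add_smul, add_assoc]) (by simpa using hf)

/-- The increment is `t` times the difference quotient, and the quotient converges. -/
theorem HasDirDerivAt.continuousAt [IsTopologicalAddGroup F] [ContinuousSMul ℝ F] {c : ℝ → F}
    {y : F} {s : ℝ} (h : HasDirDerivAt c y s 1) : ContinuousAt c s := by
  have h1 : Tendsto (fun t : ℝ => c s + t • t⁻¹ • (c (s + t • 1) - c s)) (𝓝[≠] 0)
      (𝓝 (c s + (0 : ℝ) • y)) :=
    tendsto_const_nhds.add ((tendsto_id.mono_left nhdsWithin_le_nhds).smul h)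
  have h2 : Tendsto (fun t : ℝ => c (s + t)) (𝓝[≠] 0) (𝓝 (c s)) := by
    rw [zero_smul, add_zero] at h1
    refine h1.congr' ?_
    filter_upwards [self_mem_nhdsWithin] with t ht
    have ht : t ≠ 0 := ht
    simp [smul_smul, ht]
  have h3 : ContinuousAt (fun t : ℝ => c (s + t)) 0 := by
    rw [continuousAt_iff_punctured_nhds]
    simpa using h2
  have h4 : ContinuousAt (fun r : ℝ => r - s) s := by fun_prop
  have h5 := ContinuousAt.comp (f := fun r : ℝ => r - s) (x := s) (by simpa using h3) h4
  simpa [Function.comp_def] using h5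

end DirDeriv

/-! ### Mean value theorem and convex neighbourhoods. -/

section MeanValue

variable {H F : Type*} [AddCommGroup H] [Module ℝ H]
  [AddCommGroup F] [Module ℝ F] [TopologicalSpace F]
  [IsTopologicalAddGroup F] [ContinuousSMul ℝ F] [LocallyConvexSpace ℝ F]

/-- Mean value theorem: a difference quotient of a curve lies in every closed convex set
containing its derivatives. -/
theorem slope_mem_of_dirDeriv_mem {C : Set F} (hC : Convex ℝ C) (hC' : IsClosed C) {a b : ℝ}
    (hab : a < b) {c D : ℝ → F} (hc : ContinuousOn c (Icc a b))
    (hD : ∀ s ∈ Ioo a b, HasDirDerivAt c (D s) s 1) (hDC : ∀ s ∈ Ioo a b, D s ∈ C) :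
    (b - a)⁻¹ • (c b - c a) ∈ C := by
  by_contra hn
  -- A functional `φ` separates the slope from `C`, while the real mean value theorem for `φ ∘ c`
  -- finds a derivative in `C` with the same `φ`-value.
  obtain ⟨φ, r, h1, h2⟩ := geometric_hahn_banach_closed_point hC hC' hn
  have hder : ∀ s ∈ Ioo a b, HasDerivAt (fun s => φ (c s)) (φ (D s)) s := by
    intro s hs
    rw [hasDerivAt_iff_tendsto_slope_zero]
    have h := (hD s hs).clm_comp φ
    unfold HasDirDerivAt at h
    simpa using h
  obtain ⟨s, hs, h⟩ := exists_hasDerivAt_eq_slope (fun s => φ (c s)) (fun s => φ (D s)) hab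
    (φ.continuous.comp_continuousOn hc) hder
  have h3 := h1 _ (hDC s hs)
  rw [h] at h3
  simp only [map_smul, map_sub, smul_eq_mul] at h2
  rw [div_eq_inv_mul] at h3
  exact lt_irrefl _ (h2.trans h3)

theorem exists_isClosed_convex_nhds_subset {y : F} {N : Set F} (hN : N ∈ 𝓝 y) :
    ∃ C ∈ 𝓝 y, IsClosed C ∧ Convex ℝ C ∧ C ⊆ N := by
  obtain ⟨N', ⟨hN', hcl⟩, hsub⟩ := (closed_nhds_basis y).mem_iff.1 hN
  obtain ⟨C, ⟨hC, hconv⟩, hCN⟩ := (LocallyConvexSpace.convex_basis (𝕜 := ℝ) y).mem_iff.1 hN'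
  exact ⟨closure C, mem_of_superset hC subset_closure, isClosed_closure, hconv.closure,
    (closure_minimal hCN hcl).trans hsub⟩

/-- Closed convex neighbourhoods form a basis, so limits can be tested on exactly the sets that the
mean value theorem handles. -/
theorem tendsto_of_isClosed_convex {ι : Type*} {l : Filter ι} {f : ι → F} {y : F}
    (h : ∀ C ∈ 𝓝 y, IsClosed C → Convex ℝ C → ∀ᶠ i in l, f i ∈ C) : Tendsto f l (𝓝 y) := by
  intro N hN
  obtain ⟨C, hC, h1, h2, h3⟩ := exists_isClosed_convex_nhds_subset hN
  exact (h C hC h1 h2).mono fun i hi => h3 hi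

/-- The curve `r ↦ ε⁻¹ g(x + rεv)` on `[0,1]` has derivative `D`; this rescaling covers both signs
of `ε`. -/
theorem smul_sub_mem_of_dirDeriv_mem {C : Set F} (hC : Convex ℝ C) (hC' : IsClosed C) {g : H → F}
    {x v : H} {ε : ℝ} (hε : ε ≠ 0) {D : ℝ → F}
    (hD : ∀ s ∈ Icc (0 : ℝ) 1, HasDirDerivAt g (D s) (x + (s * ε) • v) v)
    (hDC : ∀ s ∈ Icc (0 : ℝ) 1, D s ∈ C) : ε⁻¹ • (g (x + ε • v) - g x) ∈ C := by
  have hder : ∀ s ∈ Icc (0 : ℝ) 1,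
      HasDirDerivAt (fun r : ℝ => ε⁻¹ • g (x + r • ε • v)) (D s) s 1 := by
    intro s hs
    have h := (((hD s hs).smul_dir ε).const_smul ε⁻¹)
    rw [smul_smul, inv_mul_cancel₀ hε, one_smul, mul_smul] at h
    exact h.line
  have := slope_mem_of_dirDeriv_mem hC hC' zero_lt_one
    (fun s hs => (hder s hs).continuousAt.continuousWithinAt)
    (fun s hs => hder s (Ioo_subset_Icc_self hs)) (fun s hs => hDC s (Ioo_subset_Icc_self hs))
  simpa [smul_sub] using this

variable [TopologicalSpace H] [IsTopologicalAddGroup H] [ContinuousSMul ℝ H]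

/-- Convergence of difference quotients with moving base point and direction. -/
theorem tendsto_slope_of_continuousAt {ι : Type*} {l : Filter ι} {g : H → F} {df : H × H → F}
    {U : Set H} (hU : IsOpen U) {y u : H} (hy : y ∈ U) {ε : ι → ℝ} {y' u' : ι → H}
    (hε : Tendsto ε l (𝓝[≠] 0)) (hy' : Tendsto y' l (𝓝 y)) (hu' : Tendsto u' l (𝓝 u))
    (hdf : ContinuousAt df (y, u))
    (hD : ∀ᶠ i in l, ∀ x ∈ U, HasDirDerivAt g (df (x, u' i)) x (u' i)) :
    Tendsto (fun i => (ε i)⁻¹ • (g (y' i + ε i • u' i) - g (y' i))) l (𝓝 (df (y, u))) := by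
  refine tendsto_of_isClosed_convex fun C hC hcl hconv => ?_
  have hN : ∀ s ∈ Icc (0 : ℝ) 1, ∀ᶠ z : (ℝ × H × H) × ℝ in 𝓝 ((0, y, u), s),
      z.1.2.1 + (z.2 * z.1.1) • z.1.2.2 ∈ U ∧
        df (z.1.2.1 + (z.2 * z.1.1) • z.1.2.2, z.1.2.2) ∈ C := by
    intro s _
    have hc : Continuous fun z : (ℝ × H × H) × ℝ =>
        (z.1.2.1 + (z.2 * z.1.1) • z.1.2.2, z.1.2.2) := by fun_prop
    have ht := hc.tendsto ((0, y, u), s)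
    simp only [mul_zero, zero_smul, add_zero] at ht
    have h1 := ht.eventually (hdf hC)
    have h2 := ht.eventually ((hU.preimage continuous_fst).mem_nhds (show (y, u).1 ∈ U from hy))
    exact h2.and h1
  -- At step size `0` the segment collapses to `y`; compactness of `[0,1]` yields one neighbourhood
  -- that serves all points of short segments.
  have hev := isCompact_Icc.eventually_forall_of_forall_eventually
    (P := fun (z : ℝ × H × H) (s : ℝ) => z.2.1 + (s * z.1) • z.2.2 ∈ U ∧
        df (z.2.1 + (s * z.1) • z.2.2, z.2.2) ∈ C) hN
  have hlim : Tendsto (fun i => (ε i, y' i, u' i)) l (𝓝 (0, y, u)) :=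
    (hε.mono_right nhdsWithin_le_nhds).prodMk_nhds (hy'.prodMk_nhds hu')
  have hne : ∀ᶠ i in l, ε i ≠ 0 := hε.eventually self_mem_nhdsWithin
  filter_upwards [hlim.eventually hev, hne, hD] with i hi hi0 hiD
  exact smul_sub_mem_of_dirDeriv_mem hconv hcl hi0 (fun s hs => hiD _ (hi s hs).1)
    (fun s hs => (hi s hs).2)

end MeanValue

/-! ### The class `C^n` through iterated tangent maps -/

/-- `f` is `n` times continuously differentiable on `U` in the sense that the iterated tangent
maps of order at most `n` exist on `U` and extend continuously to `U'`. The values of `f` on `U'`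
are those of the continuous extension. -/
def TCk : ℕ → ∀ {H : Type u} {F : Type v} [AddCommGroup H] [Module ℝ H] [TopologicalSpace H]
    [AddCommGroup F] [Module ℝ F] [TopologicalSpace F], (H → F) → Set H → Set H → Prop
  | 0, _, _, _, _, _, _, _, _, f, _, U' => ContinuousOn f U'
  | n + 1, H, F, _, _, _, _, _, _, f, U, U' => ∃ df : H × H → F,
      (∀ x ∈ U, ∀ v, HasDirDerivAt f (df (x, v)) x v) ∧
      TCk n (fun p : H × H => (f p.1, df p)) (U ×ˢ univ) (U' ×ˢ univ)

section Tangent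

variable {H : Type u} {F : Type v} {G : Type w}
  [AddCommGroup H] [Module ℝ H] [TopologicalSpace H]
  [AddCommGroup F] [Module ℝ F] [TopologicalSpace F]
  [AddCommGroup G] [Module ℝ G] [TopologicalSpace G]

theorem TCk.continuousOn {n : ℕ} {f : H → F} {U U' : Set H} (h : TCk n f U U') :
    ContinuousOn f U' := by
  induction n generalizing H F with
  | zero => exact h
  | succ n ih =>
    obtain ⟨df, -, h⟩ := h
    have h1 := continuous_fst.comp_continuousOn (ih h)
    refine h1.comp (f := fun x : H => (x, (0 : H))) (by fun_prop) fun x hx => ⟨hx, mem_univ _⟩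

theorem TCk.mono {n : ℕ} {f : H → F} {U U' W W' : Set H} (h : TCk n f U U') (hW : W ⊆ U)
    (hW' : W' ⊆ U') : TCk n f W W' := by
  induction n generalizing H F with
  | zero => exact ContinuousOn.mono h hW'
  | succ n ih =>
    obtain ⟨df, hdf, h⟩ := h
    exact ⟨df, fun x hx => hdf x (hW hx),
      ih h (prod_mono_left hW) (prod_mono_left hW')⟩

theorem TCk.const {n : ℕ} (c : F) (U U' : Set H) : TCk n (fun _ : H => c) U U' := by
  induction n generalizing H F with
  | zero => exact continuousOn_const
  | succ n ih => exact ⟨fun _ => 0, fun x _ v => hasDirDerivAt_const c x v, ih (c, 0) _ _⟩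

theorem TCk.clm {n : ℕ} (L : H →L[ℝ] F) (U U' : Set H) : TCk n L U U' := by
  induction n generalizing H F with
  | zero => exact L.continuous.continuousOn
  | succ n ih =>
    exact ⟨fun p => L p.2, fun x _ v => hasDirDerivAt_clm L x v, ih (L.prodMap L) _ _⟩

/-- The chain rule. -/
theorem TCk.comp [IsTopologicalAddGroup H] [ContinuousSMul ℝ H] [IsTopologicalAddGroup F]
    [ContinuousSMul ℝ F] [LocallyConvexSpace ℝ F] [IsTopologicalAddGroup G] [ContinuousSMul ℝ G]
    {n : ℕ} {f : H → F} {g : G → H} {U U' : Set H} {W W' : Set G} (hU : IsOpen U) (hUU' : U ⊆ U')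
    (hf : TCk n f U U') (hg : TCk n g W W') (hW : MapsTo g W U) (hW' : MapsTo g W' U') :
    TCk n (fun x => f (g x)) W W' := by
  induction n generalizing H F G with
  | zero => exact ContinuousOn.comp hf hg hW'
  | succ n ih =>
    have hfc := hf
    obtain ⟨df, hdf, hf⟩ := hf
    obtain ⟨dg, hdg, hg⟩ := hg
    refine ⟨fun p => df (g p.1, dg p), fun x hx v => ?_, ?_⟩
    · have hc : ContinuousAt df (g x, dg (x, v)) := by
        have h1 := continuous_snd.comp_continuousOn
          (hf.continuousOn.mono (prod_mono_left hUU'))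
        exact h1.continuousAt ((hU.prod isOpen_univ).mem_nhds ⟨hW hx, mem_univ _⟩)
      -- The quotient of `f ∘ g` is a quotient of `f` at `g x` whose direction is the quotient of
      -- `g`, hence varies with `t`.
      have h := tendsto_slope_of_continuousAt (g := f) hU (hW hx) (l := 𝓝[≠] 0) (ε := id)
        (y' := fun _ => g x) (u' := fun t : ℝ => t⁻¹ • (g (x + t • v) - g x)) tendsto_id
        tendsto_const_nhds (hdg x hx v) hc (Eventually.of_forall fun i y hy => hdf y hy _)
      refine h.congr' ?_
      filter_upwards [self_mem_nhdsWithin] with t ht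
      have ht : t ≠ 0 := ht
      simp [smul_smul, ht]
    -- The tangent map of a composite is the composite of the tangent maps.
    · exact ih (hU.prod isOpen_univ) (prod_mono_left hUU') hf hg
        (fun p hp => ⟨hW hp.1, mem_univ _⟩) (fun p hp => ⟨hW' hp.1, mem_univ _⟩)

theorem TCk.clm_comp [IsTopologicalAddGroup H] [ContinuousSMul ℝ H] [IsTopologicalAddGroup F]
    [ContinuousSMul ℝ F] [IsTopologicalAddGroup G] [ContinuousSMul ℝ G] [LocallyConvexSpace ℝ G]
    {n : ℕ} {f : H → F} {U U' : Set H} (L : F →L[ℝ] G) (hf : TCk n f U U') :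
    TCk n (fun x => L (f x)) U U' :=
  (TCk.clm L univ univ).comp isOpen_univ subset_rfl hf (mapsTo_univ _ _) (mapsTo_univ _ _)

theorem TCk.comp_fst [IsTopologicalAddGroup H] [ContinuousSMul ℝ H] [IsTopologicalAddGroup F]
    [ContinuousSMul ℝ F] [LocallyConvexSpace ℝ F] [IsTopologicalAddGroup G] [ContinuousSMul ℝ G]
    {n : ℕ} {f : H → F} {U U' : Set H} (hU : IsOpen U) (hUU' : U ⊆ U')
    (hf : TCk n f U U') {W W' : Set G} :
    TCk n (fun p : H × G => f p.1) (U ×ˢ W) (U' ×ˢ W') :=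
  hf.comp hU hUU' (TCk.clm (ContinuousLinearMap.fst ℝ H G) _ _) (fun _ h => h.1) (fun _ h => h.1)

variable [IsTopologicalAddGroup H] [ContinuousSMul ℝ H] [IsTopologicalAddGroup F]
  [ContinuousSMul ℝ F] [LocallyConvexSpace ℝ F] [IsTopologicalAddGroup G] [ContinuousSMul ℝ G]
  [LocallyConvexSpace ℝ G]

theorem TCk.prodMk {n : ℕ} {f : H → F} {g : H → G} {U U' : Set H} (hf : TCk n f U U')
    (hg : TCk n g U U') : TCk n (fun x => (f x, g x)) U U' := by
  induction n generalizing H F G with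
  | zero => exact ContinuousOn.prodMk hf hg
  | succ n ih =>
    obtain ⟨df, hdf, hf⟩ := hf
    obtain ⟨dg, hdg, hg⟩ := hg
    exact ⟨fun p => (df p, dg p), fun x hx v => (hdf x hx v).prodMk (hdg x hx v),
      (ih hf hg).clm_comp (((ContinuousLinearMap.fst ℝ F F).prodMap
        (ContinuousLinearMap.fst ℝ G G)).prod ((ContinuousLinearMap.snd ℝ F F).prodMap
        (ContinuousLinearMap.snd ℝ G G)))⟩

theorem TCk.exists_dirDeriv {n : ℕ} {f : H → F} {U U' : Set H} (hf : TCk (n + 1) f U U') :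
    ∃ df : H × H → F, (∀ x ∈ U, ∀ v, HasDirDerivAt f (df (x, v)) x v) ∧
      TCk n df (U ×ˢ univ) (U' ×ˢ univ) := by
  obtain ⟨df, hdf, hf⟩ := hf
  exact ⟨df, hdf, hf.clm_comp (ContinuousLinearMap.snd ℝ F F)⟩

/-- The two components of the tangent map may be controlled separately, so later proofs only need a
formula for the derivative. -/
theorem TCk.of_dirDeriv {n : ℕ} {f : H → F} {df : H × H → F} {U U' : Set H} (hU : IsOpen U)
    (hUU' : U ⊆ U') (hf : TCk n f U U') (hdf : ∀ x ∈ U, ∀ v, HasDirDerivAt f (df (x, v)) x v)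
    (h : TCk n df (U ×ˢ univ) (U' ×ˢ univ)) : TCk (n + 1) f U U' :=
  ⟨df, hdf, (hf.comp_fst hU hUU').prodMk h⟩

theorem TCk.add {n : ℕ} {f g : H → F} {U U' : Set H} (hf : TCk n f U U') (hg : TCk n g U U') :
    TCk n (fun x => f x + g x) U U' :=
  (hf.prodMk hg).clm_comp (ContinuousLinearMap.fst ℝ F F + ContinuousLinearMap.snd ℝ F F)

theorem TCk.sum {n : ℕ} {ι : Type*} (s : Finset ι) {f : ι → H → F} {U U' : Set H}
    (hf : ∀ i ∈ s, TCk n (f i) U U') : TCk n (fun x => ∑ i ∈ s, f i x) U U' := by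
  classical
  induction s using Finset.induction_on with
  | empty => simpa using TCk.const (0 : F) U U'
  | insert i s hi ih =>
    simp only [Finset.sum_insert hi]
    exact (hf i (Finset.mem_insert_self i s)).add
      (ih fun j hj => hf j (Finset.mem_insert_of_mem hj))

theorem hasDirDerivAt_smul (p v : ℝ × F) :
    HasDirDerivAt (fun p : ℝ × F => p.1 • p.2) (p.1 • v.2 + v.1 • p.2) p v := by
  have h1 : Tendsto (fun t : ℝ => p.1 • v.2 + v.1 • p.2 + t • v.1 • v.2) (𝓝[≠] 0)
      (𝓝 (p.1 • v.2 + v.1 • p.2 + (0 : ℝ) • v.1 • v.2)) :=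
    (tendsto_const_nhds.add
      ((tendsto_id.mono_left nhdsWithin_le_nhds).smul tendsto_const_nhds))
  rw [zero_smul, add_zero] at h1
  refine h1.congr' ?_
  filter_upwards [self_mem_nhdsWithin] with t ht
  have ht : t ≠ 0 := ht
  simp only [Prod.fst_add, Prod.snd_add, Prod.smul_fst, Prod.smul_snd, smul_eq_mul]
  have h2 : (p.1 + t * v.1) • (p.2 + t • v.2) - p.1 • p.2 =
      t • (p.1 • v.2 + v.1 • p.2 + t • v.1 • v.2) := by
    module
  rw [h2, inv_smul_smul₀ ht, smul_smul]

/-- The derivative of this bilinear map is a sum of copies of itself after linear projections, so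
the induction closes. -/
theorem tCk_smul (n : ℕ) : TCk n (fun p : ℝ × F => p.1 • p.2) univ univ := by
  induction n with
  | zero => exact continuous_smul.continuousOn
  | succ n ih =>
    refine TCk.of_dirDeriv (df := fun q => q.1.1 • q.2.2 + q.2.1 • q.1.2) isOpen_univ subset_rfl ih
      (fun p _ v => hasDirDerivAt_smul p v) ?_
    refine TCk.add ?_ ?_
    · exact ih.comp isOpen_univ subset_rfl (TCk.clm ((((ContinuousLinearMap.fst ℝ ℝ F).prodMap
        (ContinuousLinearMap.snd ℝ ℝ F)))) _ _) (mapsTo_univ _ _) (mapsTo_univ _ _)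
    · exact ih.comp isOpen_univ subset_rfl (TCk.clm ((((ContinuousLinearMap.fst ℝ ℝ F).comp
        (ContinuousLinearMap.snd ℝ (ℝ × F) (ℝ × F))).prod
        ((ContinuousLinearMap.snd ℝ ℝ F).comp (ContinuousLinearMap.fst ℝ (ℝ × F) (ℝ × F))))) _ _)
        (mapsTo_univ _ _) (mapsTo_univ _ _)

theorem TCk.smul {n : ℕ} {c : H → ℝ} {f : H → F} {U U' : Set H} (hc : TCk n c U U')
    (hf : TCk n f U U') : TCk n (fun x => c x • f x) U U' :=
  (tCk_smul n).comp isOpen_univ subset_rfl (hc.prodMk hf) (mapsTo_univ _ _) (mapsTo_univ _ _)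

end Tangent

/-- The tangent map `(x, v) ↦ (f x, Df(x) v)` loses one order. This imports `exp`, `log`, the
inverse, the cutoff and the norm. -/
theorem tCk_of_contDiffOn {X : Type u} {Y : Type v} [NormedAddCommGroup X] [NormedSpace ℝ X]
    [NormedAddCommGroup Y] [NormedSpace ℝ Y] {n : ℕ} {f : X → Y} {U : Set X} (hU : IsOpen U)
    (hf : ContDiffOn ℝ n f U) : TCk n f U U := by
  induction n generalizing X Y with
  | zero => exact hf.continuousOn
  | succ n ih =>
    refine ⟨fun p => fderiv ℝ f p.1 p.2, fun x hx v => ?_, ih (hU.prod isOpen_univ) ?_⟩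
    · have h := (hf.differentiableOn (by simp)).differentiableAt (hU.mem_nhds hx)
      exact hasLineDerivAt_iff_tendsto_slope_zero.1 (h.hasFDerivAt.hasLineDerivAt v)
    · have h1 : ContDiffOn ℝ n (fderiv ℝ f) U := hf.fderiv_of_isOpen hU (by norm_cast)
      have h2 : MapsTo Prod.fst (U ×ˢ (univ : Set X)) U := fun _ h => h.1
      exact ((hf.of_le (by norm_cast; simp)).comp contDiffOn_fst h2).prodMk
        ((h1.comp contDiffOn_fst h2).clm_apply contDiffOn_snd)

/-! ### Comparison of the two notions of differentiability -/

section Comparison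

variable {H : Type u} {F : Type v}
  [AddCommGroup H] [Module ℝ H] [TopologicalSpace H]
  [IsTopologicalAddGroup H] [ContinuousSMul ℝ H]
  [AddCommGroup F] [Module ℝ F] [TopologicalSpace F]
  [IsTopologicalAddGroup F] [ContinuousSMul ℝ F] [LocallyConvexSpace ℝ F] [T2Space F]

theorem HasDirDerivAt.unique {f : H → F} {y z : F} {x v : H} (hy : HasDirDerivAt f y x v)
    (hz : HasDirDerivAt f z x v) : y = z :=
  tendsto_nhds_unique hy hz

/-- A continuous directional derivative is linear in the direction. -/
theorem dirDeriv_add_smul {g : H → F} {dg : H × H → F} {U : Set H} (hU : IsOpen U)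
    (hg : ∀ x ∈ U, ∀ v, HasDirDerivAt g (dg (x, v)) x v) (hdg : ContinuousOn dg (U ×ˢ univ))
    {x : H} (hx : x ∈ U) (a b : H) (c : ℝ) :
    dg (x, a + c • b) = dg (x, a) + c • dg (x, b) := by
  -- The increment along `a + c • b` is made in two moves: along `a` from `x`, then along `c • b`
  -- from the moving point `x + t • a`.
  have h1 : Tendsto (fun t : ℝ => t⁻¹ • (g (x + t • a + t • c • b) - g (x + t • a)))
      (𝓝[≠] 0) (𝓝 (dg (x, c • b))) := by
    have hy : Tendsto (fun t : ℝ => x + t • a) (𝓝[≠] 0) (𝓝 x) := by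
      have hc : Continuous fun t : ℝ => x + t • a := by fun_prop
      simpa using (hc.tendsto 0).mono_left nhdsWithin_le_nhds
    exact tendsto_slope_of_continuousAt (ε := id) hU hx tendsto_id hy tendsto_const_nhds
      (hdg.continuousAt ((hU.prod isOpen_univ).mem_nhds ⟨hx, mem_univ _⟩))
      (Eventually.of_forall fun _ z hz => hg z hz _)
  have h2 : HasDirDerivAt g (dg (x, c • b) + dg (x, a)) x (a + c • b) := by
    refine (Tendsto.add h1 (hg x hx a)).congr fun t => ?_
    rw [← smul_add, smul_add t, add_assoc]
    abel_nf
  rw [(hg x hx (a + c • b)).unique h2, (hg x hx (c • b)).unique ((hg x hx b).smul_dir c), add_comm]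

theorem CkOn.hasDirDerivAt {k : ℕ∞} {f : H → F} {U : Set H} (hf : CkOn k f U) {ℓ : ℕ}
    (hℓ : ((ℓ + 1 : ℕ) : ℕ∞) ≤ k) (w : Fin ℓ → H) (v : H) {x : H} (hx : x ∈ U) :
    HasDirDerivAt (fun z => differential f ℓ z w)
      (differential f (ℓ + 1) x (Fin.snoc (α := fun _ => H) w v)) x v := by
  obtain ⟨y, hy⟩ := hf.exists_dirDeriv ℓ hℓ w v x hx
  simp only [differential, Fin.init_snoc, Fin.snoc_last]
  rwa [hy.dirDeriv_eq]

theorem cast_le_of_succ_le {k : ℕ∞} {ℓ : ℕ} (hℓ : ((ℓ + 1 : ℕ) : ℕ∞) ≤ k) : (ℓ : ℕ∞) ≤ k :=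
  le_trans (by exact_mod_cast Nat.le_succ ℓ) hℓ

theorem continuous_snoc {ℓ : ℕ} :
    Continuous fun p : (Fin ℓ → H) × H => Fin.snoc (α := fun _ => H) p.1 p.2 := by
  refine continuous_pi fun i => ?_
  refine Fin.lastCases ?_ (fun j => ?_) i
  · simp only [Fin.snoc_last]; fun_prop
  · simp only [Fin.snoc_castSucc]; fun_prop

theorem continuous_init {ℓ : ℕ} :
    Continuous fun p : Fin (ℓ + 1) → H => (Fin.init p : Fin ℓ → H) :=
  continuous_pi fun i => continuous_apply i.castSucc

/-- The differentials of a map of class `C^k` are multilinear in the directions. -/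
theorem CkOn.differential_update {k : ℕ∞} {f : H → F} {U : Set H} (hU : IsOpen U)
    (hf : CkOn k f U) : ∀ (ℓ : ℕ), (ℓ : ℕ∞) ≤ k → ∀ x ∈ U, ∀ (w : Fin ℓ → H) (i : Fin ℓ)
      (a b : H) (c : ℝ), differential f ℓ x (Function.update w i (a + c • b)) =
        differential f ℓ x (Function.update w i a) +
          c • differential f ℓ x (Function.update w i b) := by
  intro ℓ
  induction ℓ with
  | zero => intro _ _ _ _ i; exact i.elim0
  | succ ℓ ih =>
    intro hℓ x hx w i a b c
    refine Fin.lastCases ?_ (fun j => ?_) i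
    · have h : ∀ a : H, Function.update w (Fin.last ℓ) a =
          Fin.snoc (α := fun _ => H) (Fin.init w) a := by
        intro a
        conv_lhs => rw [← Fin.snoc_init_self w]
        rw [Fin.update_snoc_last]
      simp only [h]
      refine dirDeriv_add_smul (dg := fun p => differential f (ℓ + 1) p.1
        (Fin.snoc (α := fun _ => H) (Fin.init w) p.2)) hU
        (fun x hx v => hf.hasDirDerivAt hℓ _ v hx) ?_ hx a b c
      refine (hf.continuousOn (ℓ + 1) hℓ).comp (f := fun p : H × H =>
        (p.1, Fin.snoc (α := fun _ => H) (Fin.init w) p.2)) ?_ fun p hp => ⟨hp.1, mem_univ _⟩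
      have hc : Continuous fun p : H × H => ((Fin.init w : Fin ℓ → H), p.2) := by fun_prop
      exact (continuous_fst.prodMk (continuous_snoc.comp hc)).continuousOn
    -- Linearity in an earlier direction is, by induction, an identity of functions on `U`; it is
    -- differentiated in the last direction.
    · have h : ∀ a : H, Function.update w j.castSucc a = Fin.snoc (α := fun _ => H)
          (Function.update (Fin.init w) j a) (w (Fin.last ℓ)) := by
        intro a
        conv_lhs => rw [← Fin.snoc_init_self w]
        rw [Fin.snoc_update]
      simp only [h]
      have h1 := hf.hasDirDerivAt hℓ (Function.update (Fin.init w) j (a + c • b))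
        (w (Fin.last ℓ)) hx
      have h2 := (hf.hasDirDerivAt hℓ (Function.update (Fin.init w) j a)
        (w (Fin.last ℓ)) hx).add_smul c (hf.hasDirDerivAt hℓ (Function.update (Fin.init w) j b)
        (w (Fin.last ℓ)) hx)
      exact h1.unique (h2.congr hU hx fun z hz =>
        (ih (cast_le_of_succ_le hℓ) z hz (Fin.init w) j a b c).symm)

/-- The vector whose first `i` components are those of `w'`, the others being those of `w`. -/
def hybrid {ℓ : ℕ} (w w' : Fin ℓ → H) (i : ℕ) : Fin ℓ → H := fun j =>
  if (j : ℕ) < i then w' j else w j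

theorem hybrid_eq_update {ℓ : ℕ} (w w' : Fin ℓ → H) (i : Fin ℓ) :
    hybrid w w' (i + 1) = Function.update (hybrid w w' i) i (w' i) := by
  funext j
  by_cases h : j = i
  · subst h; simp [hybrid]
  · have h' : (j : ℕ) ≠ i := fun e => h (Fin.ext e)
    rw [Function.update_of_ne h]
    have : ((j : ℕ) < i + 1) ↔ (j : ℕ) < i := by omega
    simp [hybrid, this]

theorem hybrid_self_update {ℓ : ℕ} (w w' : Fin ℓ → H) (i : Fin ℓ) :
    Function.update (hybrid w w' i) i (w i) = hybrid w w' i := by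
  rw [Function.update_eq_self_iff]
  simp [hybrid]

/-- The directions are changed one at a time; the difference telescopes, and multilinearity extracts
a factor `t` from each term. -/
theorem CkOn.differential_sub {k : ℕ∞} {f : H → F} {U : Set H} (hU : IsOpen U)
    (hf : CkOn k f U) {ℓ : ℕ} (hℓ : (ℓ : ℕ∞) ≤ k) {x : H} (hx : x ∈ U) (w u : Fin ℓ → H) (t : ℝ) :
    differential f ℓ x (w + t • u) - differential f ℓ x w =
      t • ∑ i : Fin ℓ, differential f ℓ x (Function.update (hybrid w (w + t • u) i) i (u i)) := by
  have h0 : hybrid w (w + t • u) 0 = w := by funext j; simp [hybrid]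
  have h1 : hybrid w (w + t • u) ℓ = w + t • u := by funext j; simp [hybrid]
  have h2 := Finset.sum_range_sub
    (fun i => differential f ℓ x (hybrid w (w + t • u) i)) ℓ
  rw [h0, h1] at h2
  rw [← h2, Finset.sum_range, Finset.smul_sum]
  refine Finset.sum_congr rfl fun i _ => ?_
  rw [hybrid_eq_update, Pi.add_apply, Pi.smul_apply,
    hf.differential_update hU ℓ hℓ x hx _ i, hybrid_self_update]
  abel

/-- The joint derivative of the `ℓ`-th differential in the base point and the directions. -/
theorem CkOn.hasDirDerivAt_joint {k : ℕ∞} {f : H → F} {U : Set H} (hU : IsOpen U)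
    (hf : CkOn k f U) {ℓ : ℕ} (hℓ : ((ℓ + 1 : ℕ) : ℕ∞) ≤ k) {x : H} (hx : x ∈ U)
    (w : Fin ℓ → H) (v : H) (u : Fin ℓ → H) :
    HasDirDerivAt (fun p : H × (Fin ℓ → H) => differential f ℓ p.1 p.2)
      (differential f (ℓ + 1) x (Fin.snoc (α := fun _ => H) w v) +
        ∑ i : Fin ℓ, differential f ℓ x (Function.update w i (u i))) (x, w) (v, u) := by
  have hℓ' := cast_le_of_succ_le hℓ
  have hxc : Continuous fun t : ℝ => x + t • v := by fun_prop
  have hsum : Tendsto (fun t : ℝ => ∑ i : Fin ℓ, differential f ℓ (x + t • v)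
      (Function.update (hybrid w (w + t • u) i) i (u i))) (𝓝[≠] 0)
      (𝓝 (∑ i : Fin ℓ, differential f ℓ x (Function.update w i (u i)))) := by
    refine tendsto_finsetSum _ fun i _ => ?_
    have hc : Continuous fun t : ℝ => (x + t • v,
        Function.update (hybrid w (w + t • u) i) i (u i)) := by
      refine hxc.prodMk (Continuous.update (continuous_pi fun j => ?_) i continuous_const)
      unfold hybrid
      split_ifs
      · simp only [Pi.add_apply, Pi.smul_apply]; fun_prop
      · exact continuous_const
    have h0 : hybrid w (w + (0 : ℝ) • u) i = w := by funext j; simp [hybrid]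
    have ht := hc.tendsto 0
    rw [h0, zero_smul, add_zero] at ht
    exact (((hf.continuousOn ℓ hℓ').continuousAt
      ((hU.prod isOpen_univ).mem_nhds (by exact ⟨hx, mem_univ _⟩))).tendsto.comp ht).mono_left
      nhdsWithin_le_nhds
  -- The base point moves first, with `w` fixed; then the directions move at base point `x + t • v`,
  -- which contributes `t` times the sum in `hsum`.
  refine (Tendsto.add (hf.hasDirDerivAt hℓ w v hx) hsum).congr' ?_
  have hmem : ∀ᶠ t : ℝ in 𝓝[≠] 0, x + t • v ∈ U := by
    apply mem_nhdsWithin_of_mem_nhds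
    apply hxc.continuousAt.preimage_mem_nhds
    simpa using hU.mem_nhds hx
  filter_upwards [hmem, self_mem_nhdsWithin] with t ht ht0
  have ht0 : t ≠ 0 := ht0
  have h := hf.differential_sub hU hℓ' ht w u t
  rw [← inv_smul_smul₀ ht0 (∑ i : Fin ℓ, _), ← h, ← smul_add]
  simp

/-- A map of class `C^k` all of whose differentials extend continuously is of class `TCk`. -/
theorem CkOn.tCk {k : ℕ∞} {f : H → F} {U U' : Set H} (hU : IsOpen U) (hUU' : U ⊆ U')
    (hf : CkOn k f U) {Ψ : ∀ ℓ : ℕ, H × (Fin ℓ → H) → F}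
    (hΨ : ∀ ℓ : ℕ, (ℓ : ℕ∞) ≤ k → ContinuousOn (Ψ ℓ) (U' ×ˢ univ))
    (hΨf : ∀ ℓ : ℕ, (ℓ : ℕ∞) ≤ k → ∀ x ∈ U, ∀ w, Ψ ℓ (x, w) = differential f ℓ x w) :
    ∀ m ℓ : ℕ, ((ℓ + m : ℕ) : ℕ∞) ≤ k → TCk m (Ψ ℓ) (U ×ˢ univ) (U' ×ˢ univ) := by
  intro m
  induction m with
  | zero => exact fun ℓ hℓ => hΨ ℓ hℓ
  | succ m ih =>
    intro ℓ hℓ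
    have hℓ1 : ((ℓ + 1 : ℕ) : ℕ∞) ≤ k :=
      le_trans (by exact_mod_cast (by omega : ℓ + 1 ≤ ℓ + (m + 1))) hℓ
    have hℓ0 := cast_le_of_succ_le hℓ1
    have ih0 : TCk m (Ψ ℓ) (U ×ˢ univ) (U' ×ˢ univ) :=
      ih ℓ (le_trans (by exact_mod_cast (by omega : ℓ + m ≤ ℓ + (m + 1))) hℓ)
    have ih1 : TCk m (Ψ (ℓ + 1)) (U ×ˢ univ) (U' ×ˢ univ) :=
      ih (ℓ + 1) (by convert hℓ using 2; omega)
    have hUo : IsOpen (U ×ˢ (univ : Set (Fin ℓ → H))) := hU.prod isOpen_univ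
    -- The joint derivative is built from `Ψ (ℓ + 1)` and `Ψ ℓ` by linear substitutions, so the
    -- induction on `m` must cover all `ℓ`; the same formula supplies the extension to `U'`.
    refine TCk.of_dirDeriv (df := fun q : (H × (Fin ℓ → H)) × (H × (Fin ℓ → H)) =>
      Ψ (ℓ + 1) (q.1.1, Fin.snoc (α := fun _ => H) q.1.2 q.2.1) +
        ∑ i : Fin ℓ, Ψ ℓ (q.1.1, Function.update q.1.2 i (q.2.2 i))) hUo
      (prod_mono_left hUU') ih0 ?_ ?_
    · rintro ⟨x, w⟩ ⟨hx, -⟩ ⟨v, u⟩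
      simp only [hΨf _ hℓ0 x hx, hΨf _ hℓ1 x hx]
      exact (hf.hasDirDerivAt_joint hU hℓ1 hx w v u).congr hUo ⟨hx, mem_univ _⟩
        fun p hp => (hΨf _ hℓ0 p.1 hp.1 p.2).symm
    · refine TCk.add ?_ (TCk.sum _ fun i _ => ?_)
      · let L : (H × (Fin ℓ → H)) × (H × (Fin ℓ → H)) →L[ℝ] H × (Fin (ℓ + 1) → H) :=
          { toFun := fun q => (q.1.1, Fin.snoc (α := fun _ => H) q.1.2 q.2.1)
            map_add' := fun p q => by
              refine Prod.ext rfl (funext fun i => ?_)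
              refine Fin.lastCases ?_ (fun j => ?_) i <;> simp
            map_smul' := fun c q => by
              refine Prod.ext rfl (funext fun i => ?_)
              refine Fin.lastCases ?_ (fun j => ?_) i <;> simp
            cont := (continuous_fst.comp continuous_fst).prodMk (continuous_snoc.comp
              ((continuous_snd.comp continuous_fst).prodMk (continuous_fst.comp continuous_snd))) }
        exact ih1.comp (hU.prod isOpen_univ) (prod_mono_left hUU') (TCk.clm L _ _)
          (fun q hq => ⟨hq.1.1, mem_univ _⟩) (fun q hq => ⟨hq.1.1, mem_univ _⟩)
      · let L : (H × (Fin ℓ → H)) × (H × (Fin ℓ → H)) →L[ℝ] H × (Fin ℓ → H) :=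
          { toFun := fun q => (q.1.1, Function.update q.1.2 i (q.2.2 i))
            map_add' := fun p q => by
              refine Prod.ext rfl (funext fun j => ?_)
              rcases eq_or_ne j i with rfl | h <;> simp [*]
            map_smul' := fun c q => by
              refine Prod.ext rfl (funext fun j => ?_)
              rcases eq_or_ne j i with rfl | h <;> simp [*]
            cont := (continuous_fst.comp continuous_fst).prodMk
              ((continuous_snd.comp continuous_fst).update i ((continuous_apply i).comp
                (continuous_snd.comp continuous_snd))) }
        exact ih0.comp (hU.prod isOpen_univ) (prod_mono_left hUU') (TCk.clm L _ _)
          (fun q hq => ⟨hq.1.1, mem_univ _⟩) (fun q hq => ⟨hq.1.1, mem_univ _⟩)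

/-- The differentials of a map of class `TCk`. -/
theorem TCk.exists_differential {n : ℕ} {f : H → F} {U U' : Set H} (hU : IsOpen U) (hUU' : U ⊆ U')
    (hf : TCk n f U U') : ∀ ℓ m : ℕ, ℓ + m = n → ∃ Ψ : H × (Fin ℓ → H) → F,
      TCk m Ψ (U ×ˢ univ) (U' ×ˢ univ) ∧ ∀ x ∈ U, ∀ w, Ψ (x, w) = differential f ℓ x w := by
  intro ℓ
  induction ℓ with
  | zero =>
    intro m hm
    rw [zero_add] at hm
    subst hm
    exact ⟨fun p => f p.1, hf.comp_fst hU hUU', fun _ _ _ => rfl⟩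
  | succ ℓ ih =>
    intro m hm
    obtain ⟨Ψ, hΨ, hΨf⟩ := ih (m + 1) (by omega)
    obtain ⟨dΨ, hdΨ, hdΨc⟩ := hΨ.exists_dirDeriv
    have hUo : IsOpen ((U ×ˢ (univ : Set (Fin ℓ → H))) ×ˢ (univ : Set (H × (Fin ℓ → H)))) :=
      (hU.prod isOpen_univ).prod isOpen_univ
    -- The zero freezes the earlier directions, leaving the derivative in the base point.
    refine ⟨fun p => dΨ ((p.1, Fin.init p.2), (p.2 (Fin.last ℓ), 0)), ?_, ?_⟩
    · let L : H × (Fin (ℓ + 1) → H) →L[ℝ] (H × (Fin ℓ → H)) × (H × (Fin ℓ → H)) :=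
        { toFun := fun p => ((p.1, Fin.init p.2), (p.2 (Fin.last ℓ), 0))
          map_add' := fun p q => by simp; rfl
          map_smul' := fun c q => by simp; rfl
          cont := (continuous_fst.prodMk (continuous_init.comp continuous_snd)).prodMk
            (((continuous_apply _).comp continuous_snd).prodMk continuous_const) }
      exact hdΨc.comp hUo (prod_mono_left (prod_mono_left hUU')) (TCk.clm L _ _)
        (fun q hq => ⟨⟨hq.1, mem_univ _⟩, mem_univ _⟩)
        (fun q hq => ⟨⟨hq.1, mem_univ _⟩, mem_univ _⟩)
    · intro x hx w
      have h1 := HasDirDerivAt.comp_affine (fun z : H => (z, Fin.init w)) (fun v => (v, 0))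
        (fun t => by simp) (hdΨ (x, Fin.init w) ⟨hx, mem_univ _⟩ (w (Fin.last ℓ), 0))
      exact (h1.congr hU hx fun z hz => hΨf z hz _).dirDeriv_eq.symm

theorem TCk.ckOn {k : ℕ∞} {f : H → F} {U U' : Set H} (hU : IsOpen U) (hUU' : U ⊆ U')
    (hf : ∀ n : ℕ, (n : ℕ∞) ≤ k → TCk n f U U') : CkOn k f U where
  exists_dirDeriv ℓ hℓ w v x hx := by
    obtain ⟨Ψ, hΨ, hΨf⟩ := (hf (ℓ + 1) hℓ).exists_differential hU hUU' ℓ 1 rfl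
    obtain ⟨dΨ, hdΨ, -⟩ := hΨ.exists_dirDeriv
    have h1 := HasDirDerivAt.comp_affine (fun z : H => (z, w)) (fun v => (v, 0))
        (fun t => by simp) (hdΨ (x, w) ⟨hx, mem_univ _⟩ (v, 0))
    exact ⟨_, h1.congr hU hx fun z hz => hΨf z hz _⟩
  continuousOn ℓ hℓ := by
    obtain ⟨Ψ, hΨ, hΨf⟩ := (hf ℓ hℓ).exists_differential hU hUU' ℓ 0 rfl
    exact (hΨ.continuousOn.mono (prod_mono_left hUU')).congr fun p hp => (hΨf p.1 hp.1 p.2).symm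

end Comparison

/-! ### Seeley's coefficients -/

section Seeley

/-- Majorant of the coefficients of the interpolation at `1` with nodes `-2 ^ j`. -/
def seeleyBound (k : ℕ) : ℝ := Real.exp 8 * ∏ j ∈ Finset.range k, 4 * 2 ^ j / 2 ^ k

theorem seeleyBound_pos (k : ℕ) : 0 < seeleyBound k :=
  mul_pos (Real.exp_pos 8) (Finset.prod_pos fun j _ => by positivity)

/-- Each of the `k` old factors is halved and the new one equals `2`; the decay is therefore faster
than any geometric rate. -/
theorem seeleyBound_succ (k : ℕ) : seeleyBound (k + 1) = 2 * (1 / 2) ^ k * seeleyBound k := by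
  have h : ∀ j ∈ Finset.range k, (4 * 2 ^ j / 2 ^ (k + 1) : ℝ) = (1 / 2) * (4 * 2 ^ j / 2 ^ k) := by
    intro j _
    rw [pow_succ]
    field_simp
  have h2 : (4 * 2 ^ k / 2 ^ (k + 1) : ℝ) = 2 := by
    rw [pow_succ]
    field_simp
    norm_num
  rw [seeleyBound, Finset.prod_range_succ, Finset.prod_congr rfl h, Finset.prod_mul_distrib, h2,
    Finset.prod_const, Finset.card_range, seeleyBound]
  ring

theorem summable_seeleyBound (p : ℕ) : Summable fun k => seeleyBound k * (2 ^ k) ^ p := by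
  have hpos : ∀ k, 0 < seeleyBound k * ((2 : ℝ) ^ k) ^ p := fun k =>
    mul_pos (seeleyBound_pos k) (by positivity)
  refine summable_of_ratio_test_tendsto_lt_one zero_lt_one
    (Eventually.of_forall fun k => (hpos k).ne') ?_
  have h : Tendsto (fun k : ℕ => 2 * 2 ^ p * (1 / 2 : ℝ) ^ k) atTop (𝓝 (2 * 2 ^ p * 0)) :=
    (tendsto_pow_atTop_nhds_zero_of_lt_one (by norm_num) (by norm_num)).const_mul _
  rw [mul_zero] at h
  refine h.congr fun k => ?_
  rw [Real.norm_of_nonneg (hpos _).le, Real.norm_of_nonneg (hpos _).le, eq_div_iff (hpos k).ne',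
    seeleyBound_succ, pow_succ (2 : ℝ) k, mul_pow]
  ring

/-- The coefficients of the interpolation at `1` with nodes `-2 ^ j`, `j < N`. -/
def seeleyApprox (N k : ℕ) : ℝ :=
  if k < N then ∏ j ∈ (Finset.range N).erase k, (1 + 2 ^ j) / (2 ^ j - 2 ^ k) else 0

/-- For `j < k` the denominator is at least `2^k / 2` in absolute value. For `j > k` the factor is
`1 + (1 + 2^k) / (2^j - 2^k)`, at most `1 + 4 · 2^{-(j-k)}`, and `1 + s ≤ exp s`. -/
theorem abs_seeley_factor_le {j k : ℕ} (hjk : j ≠ k) : |(1 + 2 ^ j : ℝ) / (2 ^ j - 2 ^ k)| ≤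
    if j < k then 4 * 2 ^ j / 2 ^ k else Real.exp (4 * (1 / 2) ^ (j - k)) := by
  have hj : (1 : ℝ) ≤ 2 ^ j := one_le_pow₀ (by norm_num)
  have hk : (1 : ℝ) ≤ 2 ^ k := one_le_pow₀ (by norm_num)
  rw [abs_div, abs_of_pos (by linarith : (0 : ℝ) < 1 + 2 ^ j)]
  split_ifs with h
  · have h1 : (2 : ℝ) * 2 ^ j ≤ 2 ^ k := by
      rw [← pow_succ']
      exact pow_le_pow_right₀ (by norm_num) h
    rw [abs_of_neg (by linarith), div_le_div_iff₀ (by linarith) (by linarith)]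
    nlinarith
  · obtain ⟨i, rfl⟩ := Nat.exists_eq_add_of_lt (lt_of_le_of_ne (not_lt.1 h) hjk.symm)
    have h1 : (2 : ℝ) ^ (k + i + 1) = 2 ^ k * (2 * 2 ^ i) := by ring
    have h2 : k + i + 1 - k = i + 1 := by omega
    have hi : (1 : ℝ) ≤ 2 ^ i := one_le_pow₀ (by norm_num)
    have h3 : (1 / 2 : ℝ) ^ (i + 1) = 1 / (2 * 2 ^ i) := by
      rw [div_pow, one_pow, pow_succ']
    rw [h2, h1, h3, abs_of_pos (by nlinarith)]
    refine le_trans ?_ (Real.add_one_le_exp _)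
    rw [div_le_iff₀ (by nlinarith)]
    have h4 : (4 * (1 / (2 * 2 ^ i)) + 1 : ℝ) * (2 ^ k * (2 * 2 ^ i) - 2 ^ k) =
        2 ^ k * (4 + 2 * 2 ^ i - 1 - 2 / 2 ^ i) := by
      field_simp
      ring
    have h5 : (2 : ℝ) / 2 ^ i ≤ 2 := div_le_self (by norm_num) hi
    rw [h4]
    nlinarith

/-- Nodes below `k` give the product in `seeleyBound`; those above form a convergent product, so the
bound is uniform in `N`. -/
theorem abs_seeleyApprox_le (N k : ℕ) : |seeleyApprox N k| ≤ seeleyBound k := by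
  unfold seeleyApprox
  split_ifs with hk
  swap
  · rw [abs_zero]; exact (seeleyBound_pos k).le
  set f : ℕ → ℝ := fun j => if j < k then 4 * 2 ^ j / 2 ^ k else Real.exp (4 * (1 / 2) ^ (j - k))
    with hf
  have hfpos : ∀ j, 0 < f j := fun j => by
    simp only [hf]; split_ifs <;> positivity
  have hfk : 1 ≤ f k := by
    simp only [hf, lt_irrefl, if_false, Nat.sub_self, pow_zero, mul_one]
    exact Real.one_le_exp (by norm_num)
  calc |∏ j ∈ (Finset.range N).erase k, (1 + 2 ^ j : ℝ) / (2 ^ j - 2 ^ k)|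
      = ∏ j ∈ (Finset.range N).erase k, |(1 + 2 ^ j : ℝ) / (2 ^ j - 2 ^ k)| := Finset.abs_prod _ _
    _ ≤ ∏ j ∈ (Finset.range N).erase k, f j := Finset.prod_le_prod (fun _ _ => abs_nonneg _)
        fun j hj => abs_seeley_factor_le (Finset.ne_of_mem_erase hj)
    -- The missing index `k` is restored at the cost of `f k = exp 4 ≥ 1`, so that the range splits
    -- cleanly at `k`.
    _ ≤ f k * ∏ j ∈ (Finset.range N).erase k, f j :=
        le_mul_of_one_le_left (Finset.prod_nonneg fun j _ => (hfpos j).le) hfk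
    _ = ∏ j ∈ Finset.range N, f j := Finset.mul_prod_erase _ _ (Finset.mem_range.2 hk)
    _ = (∏ j ∈ Finset.range k, f j) * ∏ j ∈ Finset.Ico k N, f j :=
        (Finset.prod_range_mul_prod_Ico _ hk.le).symm
    _ = (∏ j ∈ Finset.range k, 4 * 2 ^ j / 2 ^ k) *
        Real.exp (∑ i ∈ Finset.range (N - k), 4 * (1 / 2) ^ i) := by
        congr 1
        · exact Finset.prod_congr rfl fun j hj => if_pos (Finset.mem_range.1 hj)
        · rw [Real.exp_sum, Finset.prod_Ico_eq_prod_range]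
          refine Finset.prod_congr rfl fun i _ => ?_
          simp [hf]
    _ ≤ (∏ j ∈ Finset.range k, 4 * 2 ^ j / 2 ^ k) * Real.exp 8 := by
        refine mul_le_mul_of_nonneg_left (Real.exp_le_exp.2 ?_)
          (Finset.prod_nonneg fun j _ => by positivity)
        rw [← Finset.mul_sum]
        have := sum_geometric_two_le (N - k)
        linarith
    _ = seeleyBound k := mul_comm _ _

/-- `seeleyApprox N k` is the `k`-th Lagrange basis polynomial at `1`, and interpolation of `X^p` on
`N > p` nodes is exact. -/
theorem sum_seeleyApprox {N p : ℕ} (hp : p < N) :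
    ∑ k ∈ Finset.range N, seeleyApprox N k * (-2 ^ k) ^ p = 1 := by
  have hinj : Set.InjOn (fun j : ℕ => -(2 : ℝ) ^ j) (Finset.range N) := by
    intro i _ j _ h
    exact pow_right_injective₀ (by norm_num) (by norm_num) (neg_injective h)
  have h := Lagrange.eq_interpolate (f := (Polynomial.X ^ p : Polynomial ℝ)) hinj (by
    rw [Polynomial.degree_X_pow, Finset.card_range]
    exact_mod_cast hp)
  have h1 := congrArg (Polynomial.eval 1) h
  rw [Lagrange.interpolate_apply, Polynomial.eval_finsetSum] at h1
  simp only [Polynomial.eval_pow, Polynomial.eval_X, one_pow, Polynomial.eval_mul,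
    Polynomial.eval_C, Lagrange.basis, Polynomial.eval_prod, Lagrange.basisDivisor,
    Polynomial.eval_sub] at h1
  rw [h1]
  refine Finset.sum_congr rfl fun k hk => ?_
  rw [seeleyApprox, if_pos (Finset.mem_range.1 hk), mul_comm]
  congr 1
  refine Finset.prod_congr rfl fun j _ => ?_
  rw [div_eq_inv_mul]
  congr 2 <;> ring

/-- There is a rapidly decreasing sequence all of whose moments at the nodes `-2 ^ j` equal `1`. -/
theorem exists_seeley_coeff : ∃ a : ℕ → ℝ, ∀ p : ℕ,
    Summable (fun j => |a j * (-2 ^ j) ^ p|) ∧ HasSum (fun j => a j * (-2 ^ j) ^ p) 1 := by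
  -- The uniform bounds place all approximations in a compact box, which gives a coordinatewise
  -- convergent subsequence.
  obtain ⟨a, ha, φ, hφ, hlim⟩ := (isCompact_univ_pi
    fun k => isCompact_Icc (a := -seeleyBound k) (b := seeleyBound k)).tendsto_subseq
    (x := seeleyApprox) fun N k _ => abs_le.1 (abs_seeleyApprox_le N k)
  have hlim' : ∀ k, Tendsto (fun N => seeleyApprox (φ N) k) atTop (𝓝 (a k)) :=
    tendsto_pi_nhds.1 hlim
  have habs : ∀ (b : ℝ) (k p : ℕ), |b| ≤ seeleyBound k →
      |b * (-2 ^ k) ^ p| ≤ seeleyBound k * (2 ^ k) ^ p := by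
    intro b k p hb
    rw [abs_mul, abs_pow, abs_neg, abs_of_pos (by positivity : (0 : ℝ) < 2 ^ k)]
    exact mul_le_mul_of_nonneg_right hb (by positivity)
  refine ⟨a, fun p => ?_⟩
  have hsum : Summable (fun j => |a j * (-2 ^ j) ^ p|) :=
    (summable_seeleyBound p).of_nonneg_of_le (fun _ => abs_nonneg _)
      fun j => habs _ _ _ (abs_le.2 (ha j (mem_univ _)))
  refine ⟨hsum, ?_⟩
  -- The `p`-th moment of the approximations is eventually exactly `1`, and domination by
  -- `seeleyBound` carries this to the limit.
  have h1 := tendsto_tsum_of_dominated_convergence (summable_seeleyBound p)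
    (fun k => (hlim' k).mul_const ((-2 ^ k) ^ p))
    (Eventually.of_forall fun N k => habs _ k p (abs_seeleyApprox_le (φ N) k))
  have h2 : (fun N => ∑' k, seeleyApprox (φ N) k * (-2 ^ k) ^ p) =ᶠ[atTop] fun _ => 1 := by
    filter_upwards [eventually_gt_atTop p] with N hN
    rw [tsum_eq_sum (s := Finset.range (φ N)), sum_seeleyApprox (hN.trans_le (hφ.id_le N))]
    intro k hk
    rw [seeleyApprox, if_neg (by simpa using hk), zero_mul]
  have h3 := tendsto_nhds_unique (h1.congr' h2) tendsto_const_nhds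
  rw [← h3]
  exact hsum.of_abs.hasSum

end Seeley

/-! ### Differentiability through partial derivatives -/

/-- `g : ℝ × H → F` is `n` times continuously partially differentiable on `I × W`, with partial
derivatives extending continuously to `I' × W'`. -/
def PCk : ℕ → ∀ {H : Type u} {F : Type v} [AddCommGroup H] [Module ℝ H] [TopologicalSpace H]
    [AddCommGroup F] [Module ℝ F] [TopologicalSpace F], (ℝ × H → F) → Set ℝ → Set ℝ →
    Set H → Set H → Prop
  | 0, _, _, _, _, _, _, _, _, g, _, I', _, W' => ContinuousOn g (I' ×ˢ W')
  | n + 1, H, F, _, _, _, _, _, _, g, I, I', W, W' => ContinuousOn g (I' ×ˢ W') ∧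
      ∃ (gt : ℝ × H → F) (gh : ℝ × (H × H) → F),
        (∀ t ∈ I, ∀ h ∈ W, HasDirDerivAt g (gt (t, h)) (t, h) (1, 0)) ∧
        (∀ t ∈ I, ∀ h ∈ W, ∀ v, HasDirDerivAt g (gh (t, (h, v))) (t, h) (0, v)) ∧
        PCk n gt I I' W W' ∧ PCk n gh I I' (W ×ˢ univ) (W' ×ˢ univ)

section Partial

variable {H : Type u} {F : Type v}
  [AddCommGroup H] [Module ℝ H] [TopologicalSpace H]
  [AddCommGroup F] [Module ℝ F] [TopologicalSpace F]

theorem PCk.continuousOn {n : ℕ} {g : ℝ × H → F} {I I' : Set ℝ} {W W' : Set H}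
    (h : PCk n g I I' W W') : ContinuousOn g (I' ×ˢ W') := by
  cases n with
  | zero => exact h
  | succ n => exact h.1

theorem PCk.of_succ {n : ℕ} {g : ℝ × H → F} {I I' : Set ℝ} {W W' : Set H}
    (h : PCk (n + 1) g I I' W W') : PCk n g I I' W W' := by
  induction n generalizing H F with
  | zero => exact h.continuousOn
  | succ n ih =>
    obtain ⟨hc, gt, gh, h1, h2, h3, h4⟩ := h
    exact ⟨hc, gt, gh, h1, h2, ih h3, ih h4⟩

variable [IsTopologicalAddGroup H] [ContinuousSMul ℝ H] [IsTopologicalAddGroup F]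
  [ContinuousSMul ℝ F] [LocallyConvexSpace ℝ F]

/-- The partial derivatives are the total one with the directions `(1, 0)` and `(0, v)` inserted. -/
theorem TCk.pCk [LocallyConvexSpace ℝ H] {n : ℕ} {g : ℝ × H → F} {I I' : Set ℝ} {W W' : Set H}
    (hI : IsOpen I) (hII' : I ⊆ I') (hW : IsOpen W) (hWW' : W ⊆ W')
    (h : TCk n g (I ×ˢ W) (I' ×ˢ W')) :
    PCk n g I I' W W' := by
  induction n generalizing H F with
  | zero => exact h
  | succ n ih =>
    obtain ⟨dg, hdg, hc⟩ := h.exists_dirDeriv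
    have hU : IsOpen ((I ×ˢ W) ×ˢ (univ : Set (ℝ × H))) := (hI.prod hW).prod isOpen_univ
    have hUU' := prod_mono (prod_mono hII' hWW') (subset_refl (univ : Set (ℝ × H)))
    refine ⟨h.continuousOn, fun p => dg (p, (1, 0)), fun q => dg ((q.1, q.2.1), (0, q.2.2)),
      fun t ht h hh => hdg _ ⟨ht, hh⟩ _, fun t ht h hh v => hdg _ ⟨ht, hh⟩ _,
      ih hW hWW' ?_, ih (hW.prod isOpen_univ) (prod_mono_left hWW') ?_⟩
    · exact hc.comp hU hUU'
        ((TCk.clm (ContinuousLinearMap.id ℝ (ℝ × H)) _ _).prodMk (TCk.const (1, 0) _ _))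
        (fun p hp => ⟨hp, mem_univ _⟩) (fun p hp => ⟨hp, mem_univ _⟩)
    · exact hc.comp hU hUU' (TCk.clm (((ContinuousLinearMap.fst ℝ ℝ (H × H)).prod
        ((ContinuousLinearMap.fst ℝ H H).comp (ContinuousLinearMap.snd ℝ ℝ (H × H)))).prod
        ((0 : ℝ × (H × H) →L[ℝ] ℝ).prod
        ((ContinuousLinearMap.snd ℝ H H).comp (ContinuousLinearMap.snd ℝ ℝ (H × H))))) _ _)
        (fun p hp => ⟨⟨hp.1, hp.2.1⟩, mem_univ _⟩) (fun p hp => ⟨⟨hp.1, hp.2.1⟩, mem_univ _⟩)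

/-- An increment along `(σ, v)` is a time increment followed by a space increment from a moving base
point; continuity of the space derivative gives the limit of the latter. -/
theorem PCk.tCk {n : ℕ} {g : ℝ × H → F} {I I' : Set ℝ} {W W' : Set H} (hI : IsOpen I)
    (hII' : I ⊆ I') (hW : IsOpen W) (hWW' : W ⊆ W') (h : PCk n g I I' W W') :
    TCk n g (I ×ˢ W) (I' ×ˢ W') := by
  induction n generalizing H F with
  | zero => exact h
  | succ n ih =>
    have h0 := ih hW hWW' h.of_succ
    obtain ⟨hc, gt, gh, h1, h2, h3, h4⟩ := h
    have h3' := ih hW hWW' h3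
    have h4' := ih (hW.prod isOpen_univ) (prod_mono_left hWW') h4
    refine TCk.of_dirDeriv (df := fun q : (ℝ × H) × (ℝ × H) =>
      gh (q.1.1, (q.1.2, q.2.2)) + q.2.1 • gt q.1) (hI.prod hW) (prod_mono hII' hWW') h0 ?_ ?_
    · rintro ⟨t, x⟩ ⟨ht, hx⟩ ⟨σ, v⟩
      have hy : Tendsto (fun s : ℝ => (t, x) + s • (σ, (0 : H))) (𝓝[≠] 0) (𝓝 (t, x)) := by
        have hc : Continuous fun s : ℝ => (t, x) + s • (σ, (0 : H)) := by fun_prop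
        simpa using (hc.tendsto 0).mono_left nhdsWithin_le_nhds
      have hcont : ContinuousAt (fun q : (ℝ × H) × (ℝ × H) => gh (q.1.1, (q.1.2, v)))
          ((t, x), (0, v)) := by
        have h5 : ContinuousAt gh (t, (x, v)) := h4.continuousOn.continuousAt
          (mem_of_superset ((hI.prod (hW.prod isOpen_univ)).mem_nhds ⟨ht, hx, mem_univ v⟩)
            (prod_mono hII' (prod_mono hWW' subset_rfl)))
        have h6 : Continuous fun q : (ℝ × H) × (ℝ × H) => (q.1.1, (q.1.2, v)) := by fun_prop
        exact ContinuousAt.comp (f := fun q : (ℝ × H) × (ℝ × H) => (q.1.1, (q.1.2, v)))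
          (by exact h5) h6.continuousAt
      have ha := tendsto_slope_of_continuousAt (g := g) (l := 𝓝[≠] 0) (ε := id)
        (u' := fun _ => ((0 : ℝ), v)) (hI.prod hW) (show (t, x) ∈ I ×ˢ W from ⟨ht, hx⟩)
        tendsto_id hy tendsto_const_nhds hcont
        (Eventually.of_forall fun _ y hy => h2 y.1 hy.1 y.2 hy.2 v)
      have hb := (h1 t ht x hx).smul_dir σ
      refine (Tendsto.add ha hb).congr fun s => ?_
      simp only [id]
      rw [← smul_add]
      simp
    · refine TCk.add ?_ (TCk.smul ?_ ?_)
      · exact h4'.comp (hI.prod (hW.prod isOpen_univ)) (prod_mono hII' (prod_mono_left hWW'))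
          (TCk.clm (((ContinuousLinearMap.fst ℝ ℝ H).comp
            (ContinuousLinearMap.fst ℝ (ℝ × H) (ℝ × H))).prod
            ((ContinuousLinearMap.snd ℝ ℝ H).prodMap (ContinuousLinearMap.snd ℝ ℝ H))) _ _)
          (fun q hq => ⟨hq.1.1, hq.1.2, mem_univ _⟩) (fun q hq => ⟨hq.1.1, hq.1.2, mem_univ _⟩)
      · exact TCk.clm ((ContinuousLinearMap.fst ℝ ℝ H).comp
            (ContinuousLinearMap.snd ℝ (ℝ × H) (ℝ × H))) _ _
      · exact h3'.comp_fst (hI.prod hW) (prod_mono hII' hWW')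

end Partial

/-! ### Seeley's extension operator -/

/-- Seeley's extension of `g`, given on `[0, ∞) × Y`, to `ℝ × Y` by weighted reflections. -/
def seeley {Y F : Type*} [AddCommGroup F] [Module ℝ F] [TopologicalSpace F] (α : ℕ → ℝ)
    (g : ℝ × Y → F) (p : ℝ × Y) : F :=
  if 0 ≤ p.1 then g p else ∑' j, α j • g (-2 ^ j * p.1, p.2)

section SeeleyAlgebra

variable {Y F : Type*} [AddCommGroup F] [Module ℝ F] [TopologicalSpace F]

theorem seeley_of_nonneg {α : ℕ → ℝ} {g : ℝ × Y → F} {p : ℝ × Y} (h : 0 ≤ p.1) :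
    seeley α g p = g p := if_pos h

theorem seeley_of_neg {α : ℕ → ℝ} {g : ℝ × Y → F} {p : ℝ × Y} (h : p.1 < 0) :
    seeley α g p = ∑' j, α j • g (-2 ^ j * p.1, p.2) := if_neg (not_le.2 h)

/-- One `N` serves all `t ≤ t₀`; with the cutoff, Seeley's series is then a finite sum with a fixed
number of terms. -/
theorem exists_reflection_gt (c : ℝ) {t₀ : ℝ} (ht₀ : t₀ < 0) :
    ∃ N : ℕ, ∀ t ≤ t₀, ∀ j, N ≤ j → c < -2 ^ j * t := by
  obtain ⟨N, hN⟩ := pow_unbounded_of_one_lt (c / -t₀) (one_lt_two : (1 : ℝ) < 2)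
  refine ⟨N, fun t ht j hj => ?_⟩
  rw [div_lt_iff₀ (by linarith)] at hN
  have h1 : (2 : ℝ) ^ N ≤ 2 ^ j := pow_le_pow_right₀ (by norm_num) hj
  have h2 : (0 : ℝ) < 2 ^ j := by positivity
  nlinarith

theorem seeley_eq_sum {α : ℕ → ℝ} {g : ℝ × Y → F} {c t : ℝ} {y : Y} {N : ℕ}
    (hg : ∀ s > c, g (s, y) = 0) (ht : t < 0) (hN : ∀ j, N ≤ j → c < -2 ^ j * t) :
    seeley α g (t, y) = ∑ j ∈ Finset.range N, α j • g (-2 ^ j * t, y) := by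
  rw [seeley_of_neg ht]
  refine tsum_eq_sum fun j hj => ?_
  rw [hg _ (hN j (by simpa using hj)), smul_zero]

end SeeleyAlgebra

/-! ### Continuity of Seeley's extension. -/

section SeeleyContinuity

variable {Y F : Type*} [TopologicalSpace Y] [AddCommGroup F] [Module ℝ F] [TopologicalSpace F]
  [IsTopologicalAddGroup F] [ContinuousSMul ℝ F] [LocallyConvexSpace ℝ F] [T2Space F]

/-- As the coefficients sum to `1`, a constant can be subtracted termwise; it will be the boundary
value. -/
theorem hasSum_seeley_sub {α : ℕ → ℝ} {g : ℝ × Y → F} {c t : ℝ} {y : Y}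
    (hg : ∀ s > c, g (s, y) = 0) (ht : t < 0) (hα : HasSum α 1) (z : F) :
    HasSum (fun j => α j • (g (-2 ^ j * t, y) - z)) (seeley α g (t, y) - z) := by
  obtain ⟨N, hN⟩ := exists_reflection_gt c ht
  have h1 : HasSum (fun j => α j • g (-2 ^ j * t, y)) (seeley α g (t, y)) := by
    rw [seeley_eq_sum hg ht (hN t le_rfl)]
    refine hasSum_sum_of_ne_finset_zero fun j hj => ?_
    rw [hg _ (hN t le_rfl j (by simpa using hj)), smul_zero]
  have h2 := h1.sub (hα.smul_const z)
  simpa only [smul_sub, one_smul] using h2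

/-- Reduces continuity at `t = 0` to a real series; written with `|t|`, its terms make sense on both
sides of `0`. -/
theorem seminorm_seeley_sub_le {α : ℕ → ℝ} {g : ℝ × Y → F} {c t : ℝ} {y : Y}
    (hg : ∀ s > c, g (s, y) = 0) (ht : t < 0) (hα : HasSum α 1) (z : F) {q : Seminorm ℝ F}
    (hq : Continuous q) (hs : Summable fun j => |α j| * q (g (2 ^ j * |t|, y) - z)) :
    q (seeley α g (t, y) - z) ≤ ∑' j, |α j| * q (g (2 ^ j * |t|, y) - z) := by
  have h1 := hasSum_seeley_sub hg ht hα z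
  have h2 : Tendsto (fun s : Finset ℕ => q (∑ j ∈ s, α j • (g (-2 ^ j * t, y) - z))) atTop
      (𝓝 (q (seeley α g (t, y) - z))) := (hq.tendsto _).comp h1
  refine le_of_tendsto h2 (Eventually.of_forall fun s => ?_)
  refine le_trans (Finset.le_sum_of_subadditive q (map_zero q).le (map_add_le_add q) _ _)
    (le_trans (le_of_eq ?_) (hs.sum_le_tsum s fun j _ =>
      mul_nonneg (abs_nonneg _) (apply_nonneg q _)))
  refine Finset.sum_congr rfl fun j _ => ?_
  rw [map_smul_eq_mul, Real.norm_eq_abs, abs_of_neg ht, neg_mul_comm]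

/-- Compactness of `[0, c]` and vanishing beyond `c` give the constant that dominates the series. -/
theorem eventually_seminorm_le {g : ℝ × Y → F} (hg : Continuous g) {c : ℝ}
    (hgc : ∀ s > c, ∀ y, g (s, y) = 0) (y₀ : Y) (z : F) {q : Seminorm ℝ F} (hq : Continuous q) :
    ∃ C, ∀ᶠ y in 𝓝 y₀, ∀ s, 0 ≤ s → q (g (s, y) - z) ≤ C := by
  have hqg : Continuous fun p : ℝ × Y => q (g p - z) := hq.comp (hg.sub continuous_const)
  obtain ⟨C, hC⟩ := isCompact_Icc.exists_bound_of_continuousOn (s := Icc (0 : ℝ) c)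
    (f := fun s => q (g (s, y₀) - z))
    (hqg.comp (f := fun s : ℝ => (s, y₀)) (by fun_prop)).continuousOn
  have h1 : ∀ᶠ y in 𝓝 y₀, ∀ s ∈ Icc (0 : ℝ) c, q (g (s, y) - z) < C + 1 := by
    refine isCompact_Icc.eventually_forall_of_forall_eventually
      (P := fun (y : Y) (s : ℝ) => q (g (s, y) - z) < C + 1) fun s hs => ?_
    have h2 : Continuous fun p : Y × ℝ => q (g (p.2, p.1) - z) :=
      hqg.comp (continuous_snd.prodMk continuous_fst)
    refine h2.tendsto (y₀, s) |>.eventually_lt_const ?_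
    have := (le_abs_self _).trans (hC s hs)
    linarith
  refine ⟨max (C + 1) (q (0 - z)), h1.mono fun y hy s hs => ?_⟩
  rcases le_or_gt s c with h | h
  · exact le_max_of_le_left (hy s ⟨hs, h⟩).le
  · rw [hgc s h y]
    exact le_max_right _ _

theorem tendsto_tsum_seminorm {α : ℕ → ℝ} (hα : Summable fun j => |α j|) {g : ℝ × Y → F}
    (hg : Continuous g) {c : ℝ} (hgc : ∀ s > c, ∀ y, g (s, y) = 0) (y₀ : Y) {q : Seminorm ℝ F}
    (hq : Continuous q) :
    (∀ᶠ p : ℝ × Y in 𝓝 (0, y₀), Summable fun j =>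
      |α j| * q (g (2 ^ j * |p.1|, p.2) - g (0, y₀))) ∧
    Tendsto (fun p : ℝ × Y => ∑' j, |α j| * q (g (2 ^ j * |p.1|, p.2) - g (0, y₀)))
      (𝓝 (0, y₀)) (𝓝 0) := by
  obtain ⟨C, hC⟩ := eventually_seminorm_le hg hgc y₀ (g (0, y₀)) hq
  have hb : ∀ᶠ p : ℝ × Y in 𝓝 (0, y₀), ∀ j : ℕ,
      ‖|α j| * q (g (2 ^ j * |p.1|, p.2) - g (0, y₀))‖ ≤ |α j| * C := by
    filter_upwards [(continuous_snd.tendsto ((0 : ℝ), y₀)).eventually hC] with p hp j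
    rw [Real.norm_of_nonneg (mul_nonneg (abs_nonneg _) (apply_nonneg q _))]
    exact mul_le_mul_of_nonneg_left (hp _ (by positivity)) (abs_nonneg _)
  refine ⟨hb.mono fun p hp => Summable.of_norm_bounded (hα.mul_right C) hp, ?_⟩
  have h := tendsto_tsum_of_dominated_convergence (𝓕 := 𝓝 ((0 : ℝ), y₀))
    (f := fun p j => |α j| * q (g (2 ^ j * |p.1|, p.2) - g (0, y₀))) (g := fun _ => 0)
    (hα.mul_right C) (fun j => ?_) hb
  · simpa using h
  · have hc : Continuous fun p : ℝ × Y => |α j| * q (g (2 ^ j * |p.1|, p.2) - g (0, y₀)) := by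
      have h1 : Continuous fun p : ℝ × Y => g (2 ^ j * |p.1|, p.2) := hg.comp (by fun_prop)
      exact continuous_const.mul (hq.comp (h1.sub continuous_const))
    have := hc.tendsto (0, y₀)
    simpa using this

theorem continuous_seeley {α : ℕ → ℝ} (hα : Summable fun j => |α j|) (hα1 : HasSum α 1)
    {g : ℝ × Y → F} (hg : Continuous g) {c : ℝ} (hgc : ∀ s > c, ∀ y, g (s, y) = 0) :
    Continuous (seeley α g) := by
  rw [continuous_iff_continuousAt]
  rintro ⟨t₀, y₀⟩
  rcases lt_trichotomy t₀ 0 with ht | rfl | ht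
  -- The threshold `t₀ / 2` leaves an open neighbourhood of `t₀` on which the same `N` works.
  · obtain ⟨N, hN⟩ := exists_reflection_gt c (show t₀ / 2 < 0 by linarith)
    have hc : Continuous fun p : ℝ × Y => ∑ j ∈ Finset.range N, α j • g (-2 ^ j * p.1, p.2) := by
      refine continuous_finsetSum _ fun j _ => Continuous.const_smul (hg.comp ?_) _
      fun_prop
    refine hc.continuousAt.congr ?_
    have hn : ∀ᶠ p : ℝ × Y in 𝓝 (t₀, y₀), p.1 < t₀ / 2 :=
      (continuous_fst.tendsto (t₀, y₀)).eventually_lt_const (by simp only; linarith)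
    filter_upwards [hn] with p hp
    exact (seeley_eq_sum (fun s hs => hgc s hs _) (by linarith) (hN _ hp.le)).symm
  · have hw := with_gaugeSeminormFamily (𝕜 := ℝ) (E := F)
    rw [ContinuousAt, hw.tendsto_nhds]
    intro i ε hε
    obtain ⟨hs, ht⟩ := tendsto_tsum_seminorm hα hg hgc y₀ (hw.continuous_seminorm i)
    have h1 : ∀ᶠ p : ℝ × Y in 𝓝 (0, y₀), gaugeSeminormFamily ℝ F i (g p - g (0, y₀)) < ε :=
      (hw.tendsto_nhds _ _).1 hg.continuousAt i ε hε
    filter_upwards [hs, ht.eventually_lt_const hε, h1] with p hp1 hp2 hp3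
    rw [seeley_of_nonneg (p := ((0 : ℝ), y₀)) le_rfl]
    rcases le_or_gt 0 p.1 with h | h
    · rwa [seeley_of_nonneg h]
    · exact (seminorm_seeley_sub_le (fun s hs => hgc s hs p.2) h hα1 _ (hw.continuous_seminorm i)
        hp1).trans_lt hp2
  · refine hg.continuousAt.congr ?_
    have hn : ∀ᶠ p : ℝ × Y in 𝓝 (t₀, y₀), 0 < p.1 :=
      (continuous_fst.tendsto (t₀, y₀)).eventually_const_lt ht
    exact hn.mono fun p hp => (seeley_of_nonneg hp.le).symm

theorem continuousOn_seeley {α : ℕ → ℝ} (hα : Summable fun j => |α j|) (hα1 : HasSum α 1)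
    {g : ℝ × Y → F} {W : Set Y} (hg : ContinuousOn g (Ici 0 ×ˢ W)) {c : ℝ} (hc0 : 0 ≤ c)
    (hgc : ∀ s > c, ∀ y ∈ W, g (s, y) = 0) : ContinuousOn (seeley α g) (univ ×ˢ W) := by
  -- Only times `≥ 0` enter `seeley`, so freezing `g` below `0` makes it globally continuous without
  -- changing its extension.
  have h1 : Continuous fun p : ℝ × W => g (max p.1 0, p.2) :=
    hg.comp_continuous (by fun_prop) fun p => ⟨mem_Ici.2 (le_max_right _ _), p.2.2⟩
  have h2 := continuous_seeley hα hα1 h1 (c := c) fun s hs y => by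
    simp only
    rw [max_eq_left (hc0.trans hs.le), hgc s hs _ y.2]
  rw [continuousOn_iff_continuous_domRestrict]
  refine (h2.comp (f := fun p : (univ : Set ℝ) ×ˢ W => (p.1.1, (⟨p.1.2, p.2.2⟩ : W)))
    (by fun_prop)).congr ?_
  rintro ⟨⟨t, y⟩, ht⟩
  simp only [Function.comp_apply, domRestrict_apply, seeley]
  split_ifs with h
  · rw [max_eq_left h]
  · refine tsum_congr fun j => ?_
    rw [max_eq_left]
    have : (0 : ℝ) < 2 ^ j := by positivity
    nlinarith [not_le.1 h]

end SeeleyContinuity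

/-! ### Differentiability of Seeley's extension. -/

section SeeleyDeriv

variable {H : Type u} {F : Type v}
  [AddCommGroup H] [Module ℝ H] [TopologicalSpace H]
  [IsTopologicalAddGroup H] [ContinuousSMul ℝ H]
  [AddCommGroup F] [Module ℝ F] [TopologicalSpace F]
  [IsTopologicalAddGroup F] [ContinuousSMul ℝ F] [LocallyConvexSpace ℝ F] [T2Space F]

theorem hasDirDerivAt_time_iff {g : ℝ × H → F} {y : F} {t : ℝ} {h : H} :
    HasDirDerivAt g y (t, h) (1, 0) ↔ HasDirDerivAt (fun s : ℝ => g (s, h)) y t 1 := by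
  simp [HasDirDerivAt]

/-- A continuous curve which is differentiable off `0`, with derivative extending continuously
to `0`, is differentiable at `0`. -/
theorem hasDirDerivAt_zero_of_ne {c D : ℝ → F} (hc : Continuous c) (hD : ContinuousAt D 0)
    (h : ∀ s ≠ 0, HasDirDerivAt c (D s) s 1) : HasDirDerivAt c (D 0) 0 1 := by
  refine tendsto_of_isClosed_convex fun C hC hcl hconv => ?_
  obtain ⟨δ, hδ, hball⟩ := Metric.mem_nhds_iff.1 (hD hC)
  have hev : ∀ᶠ ε : ℝ in 𝓝[≠] 0, ε ∈ Metric.ball (0 : ℝ) δ :=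
    mem_nhdsWithin_of_mem_nhds (Metric.ball_mem_nhds 0 hδ)
  filter_upwards [hev, self_mem_nhdsWithin] with ε hε hε0
  have hε0 : ε ≠ 0 := hε0
  rw [Metric.mem_ball, Real.dist_eq, sub_zero, abs_lt] at hε
  have hmem : ∀ s, -δ < s → s < δ → D s ∈ C := fun s h1 h2 =>
    hball (by rw [Metric.mem_ball, Real.dist_eq, sub_zero, abs_lt]; exact ⟨h1, h2⟩)
  simp only [smul_eq_mul, mul_one, zero_add]
  rcases lt_or_gt_of_ne hε0 with hlt | hgt
  · have := slope_mem_of_dirDeriv_mem hconv hcl hlt hc.continuousOn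
      (fun s hs => h s hs.2.ne) (fun s hs => hmem s (by linarith [hs.1]) (by linarith [hs.2]))
    rwa [zero_sub, inv_neg, neg_smul, ← smul_neg, neg_sub] at this
  · have := slope_mem_of_dirDeriv_mem hconv hcl hgt hc.continuousOn
      (fun s hs => h s hs.1.ne') (fun s hs => hmem s (by linarith [hs.1]) (by linarith [hs.2]))
    rwa [sub_zero] at this

theorem continuousAt_time {g : ℝ × H → F} {W : Set H} (hg : ContinuousOn g (univ ×ˢ W)) {h : H}
    (hh : h ∈ W) : Continuous fun t : ℝ => g (t, h) :=
  hg.comp_continuous (by fun_prop) fun _ => ⟨mem_univ _, hh⟩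

/-- Differentiating each reflection `s ↦ -2^j s` turns `α` into `β`. At `t = 0`, continuity of both
extensions, where both coefficient sums equal `1`, suffices by `hasDirDerivAt_zero_of_ne`. -/
theorem hasDirDerivAt_seeley_time {α β : ℕ → ℝ} (hβα : ∀ j, β j = α j * (-2 ^ j))
    (hα : Summable fun j => |α j|) (hα1 : HasSum α 1) (hβ : Summable fun j => |β j|)
    (hβ1 : HasSum β 1) {g gt : ℝ × H → F} {W W' : Set H} (hWW' : W ⊆ W')
    (hg : ContinuousOn g (Ici 0 ×ˢ W')) (hgt : ContinuousOn gt (Ici 0 ×ˢ W'))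
    {c : ℝ} (hc0 : 0 ≤ c) (hgc : ∀ s > c, ∀ y ∈ W', g (s, y) = 0)
    (hgtc : ∀ s > c, ∀ y ∈ W', gt (s, y) = 0)
    (hd : ∀ t ∈ Ioi (0 : ℝ), ∀ h ∈ W, HasDirDerivAt g (gt (t, h)) (t, h) (1, 0)) (t : ℝ) {h : H}
    (hh : h ∈ W) : HasDirDerivAt (seeley α g) (seeley β gt (t, h)) (t, h) (1, 0) := by
  rw [hasDirDerivAt_time_iff]
  have hne : ∀ t ≠ 0, HasDirDerivAt (fun s => seeley α g (s, h)) (seeley β gt (t, h)) t 1 := by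
    intro t ht0
    rcases lt_or_gt_of_ne ht0 with ht | ht
    · obtain ⟨N, hN⟩ := exists_reflection_gt c (show t / 2 < 0 by linarith)
      have ht2 : t ∈ Iio (t / 2) := by rw [mem_Iio]; linarith
      have heq : EqOn (fun s => ∑ j ∈ Finset.range N, α j • g (-2 ^ j * s, h))
          (fun s => seeley α g (s, h)) (Iio (t / 2)) := fun s hs =>
        (seeley_eq_sum (fun r hr => hgc r hr h (hWW' hh))
          (by rw [mem_Iio] at hs; linarith) (hN s (le_of_lt hs))).symm
      refine HasDirDerivAt.congr isOpen_Iio ht2 heq ?_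
      rw [seeley_eq_sum (fun r hr => hgtc r hr h (hWW' hh)) ht (hN t (le_of_lt ht2))]
      refine HasDirDerivAt.sum _ fun j _ => ?_
      rw [hβα, mul_smul]
      refine HasDirDerivAt.const_smul _ ?_
      have hpos : (0 : ℝ) < -2 ^ j * t := by
        have : (0 : ℝ) < 2 ^ j := by positivity
        nlinarith
      have h1 := (hasDirDerivAt_time_iff.1 (hd _ hpos h hh)).smul_dir (-2 ^ j)
      exact HasDirDerivAt.comp_affine (fun s : ℝ => -2 ^ j * s) (fun s => (-2 ^ j : ℝ) • s)
        (fun r => by simp only [smul_eq_mul]; ring) h1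
    · refine HasDirDerivAt.congr isOpen_Ioi (show t ∈ Ioi (0 : ℝ) from ht)
        (fun s hs => (seeley_of_nonneg (p := (s, h)) (le_of_lt hs)).symm) ?_
      rw [seeley_of_nonneg (p := (t, h)) ht.le]
      exact hasDirDerivAt_time_iff.1 (hd t ht h hh)
  rcases eq_or_ne t 0 with rfl | ht
  · exact hasDirDerivAt_zero_of_ne (D := fun t => seeley β gt (t, h))
      (continuousAt_time (continuousOn_seeley hα hα1 hg hc0 hgc) (hWW' hh))
      (continuousAt_time (continuousOn_seeley hβ hβ1 hgt hc0 hgtc) (hWW' hh)).continuousAt hne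
  · exact hne t ht

/-- The mean value theorem is applied on slices `t > 0` parallel to the boundary; since `C` is
closed, its conclusion survives `t ↓ 0`. -/
theorem hasDirDerivAt_boundary {g : ℝ × H → F} {gh : ℝ × (H × H) → F} {W W' : Set H}
    (hW : IsOpen W) (hWW' : W ⊆ W') (hg : ContinuousOn g (Ici 0 ×ˢ W'))
    (hgh : ContinuousOn gh (Ici 0 ×ˢ (W' ×ˢ univ)))
    (hd : ∀ t ∈ Ioi (0 : ℝ), ∀ h ∈ W, ∀ v, HasDirDerivAt g (gh (t, (h, v))) (t, h) (0, v)) {h : H}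
    (hh : h ∈ W) (v : H) : HasDirDerivAt g (gh (0, (h, v))) (0, h) (0, v) := by
  refine tendsto_of_isClosed_convex fun C hC hcl hconv => ?_
  have hpt : ((0 : ℝ), (h, v)) ∈ Ici (0 : ℝ) ×ˢ (W' ×ˢ (univ : Set H)) :=
    ⟨mem_Ici.2 le_rfl, hWW' hh, mem_univ _⟩
  have hN : ∀ᶠ z : ℝ × (H × H) in 𝓝 (0, (h, v)), z ∈ Ici (0 : ℝ) ×ˢ (W' ×ˢ (univ : Set H)) →
      gh z ∈ C := mem_nhdsWithin_iff_eventually.1 ((hgh _ hpt) hC)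
  have hs : ∀ s ∈ Icc (0 : ℝ) 1, ∀ᶠ z : (ℝ × ℝ) × ℝ in 𝓝 ((0, 0), s),
      h + (z.2 * z.1.1) • v ∈ W ∧ (0 < z.1.2 → gh (z.1.2, (h + (z.2 * z.1.1) • v, v)) ∈ C) := by
    intro s _
    have hc : Continuous fun z : (ℝ × ℝ) × ℝ => (z.1.2, (h + (z.2 * z.1.1) • v, v)) := by fun_prop
    have ht := hc.tendsto ((0, 0), s)
    simp only [mul_zero, zero_smul, add_zero] at ht
    have hmem : ∀ᶠ z : ℝ × (H × H) in 𝓝 ((0 : ℝ), (h, v)), z.2.1 ∈ W :=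
      (hW.preimage (continuous_fst.comp continuous_snd)).mem_nhds hh
    filter_upwards [ht.eventually hN, ht.eventually hmem] with z h1 h2
    exact ⟨h2, fun h3 => h1 ⟨mem_Ici.2 h3.le, hWW' h2, mem_univ _⟩⟩
  have hev := isCompact_Icc.eventually_forall_of_forall_eventually
    (P := fun (z : ℝ × ℝ) (s : ℝ) => h + (s * z.1) • v ∈ W ∧
      (0 < z.2 → gh (z.2, (h + (s * z.1) • v, v)) ∈ C)) hs
  rw [nhds_prod_eq] at hev
  -- Currying fixes `ε` first, so that `t` can tend to `0` on its own.
  filter_upwards [mem_nhdsWithin_of_mem_nhds hev.curry, self_mem_nhdsWithin] with ε hε hε0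
  have hε0 : ε ≠ 0 := hε0
  have hq : ∀ᶠ t : ℝ in 𝓝[>] 0, ε⁻¹ • (g (t, h + ε • v) - g (t, h)) ∈ C := by
    filter_upwards [mem_nhdsWithin_of_mem_nhds hε, self_mem_nhdsWithin] with t ht ht0
    have h1 := smul_sub_mem_of_dirDeriv_mem hconv hcl hε0 (g := g) (x := (t, h)) (v := (0, v))
      (D := fun s => gh (t, (h + (s * ε) • v, v)))
      (fun s hs => by simpa using hd t ht0 _ (ht s hs).1 v) (fun s hs => (ht s hs).2 ht0)
    simpa using h1
  have hlim : ∀ y ∈ W, Tendsto (fun t : ℝ => g (t, y)) (𝓝[>] 0) (𝓝 (g (0, y))) := by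
    intro y hy
    have h1 : ContinuousOn (fun t : ℝ => g (t, y)) (Ici 0) :=
      hg.comp (by fun_prop) fun t ht => ⟨ht, hWW' hy⟩
    exact (h1 0 (mem_Ici.2 le_rfl)).mono_left (nhdsWithin_mono _ Ioi_subset_Ici_self)
  have hεW : h + ε • v ∈ W := by
    obtain ⟨t, ht⟩ := hε.exists
    simpa using (ht 1 ⟨zero_le_one, le_rfl⟩).1
  have := hcl.mem_of_tendsto (((hlim _ hεW).sub (hlim _ hh)).const_smul ε⁻¹) hq
  simpa using this

/-- The number of terms depends on `t` alone, so for fixed `t < 0` a single finite sum is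
differentiated over `W`. -/
theorem hasDirDerivAt_seeley_space {α : ℕ → ℝ} {g : ℝ × H → F} {gh : ℝ × (H × H) → F}
    {W W' : Set H} (hW : IsOpen W) (hWW' : W ⊆ W') (hg : ContinuousOn g (Ici 0 ×ˢ W'))
    (hgh : ContinuousOn gh (Ici 0 ×ˢ (W' ×ˢ univ))) {c : ℝ}
    (hgc : ∀ s > c, ∀ y ∈ W', g (s, y) = 0)
    (hghc : ∀ s > c, ∀ y ∈ W' ×ˢ (univ : Set H), gh (s, y) = 0)
    (hd : ∀ t ∈ Ioi (0 : ℝ), ∀ h ∈ W, ∀ v, HasDirDerivAt g (gh (t, (h, v))) (t, h) (0, v)) (t : ℝ)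
    {h : H} (hh : h ∈ W) (v : H) :
    HasDirDerivAt (seeley α g) (seeley α gh (t, (h, v))) (t, h) (0, v) := by
  have hd' : ∀ t ≥ (0 : ℝ), HasDirDerivAt g (gh (t, (h, v))) (t, h) (0, v) := by
    intro t ht
    rcases ht.eq_or_lt with rfl | ht
    · exact hasDirDerivAt_boundary hW hWW' hg hgh hd hh v
    · exact hd t ht h hh v
  have hvar : ∀ {f : ℝ × H → F} {y : F} {t : ℝ},
      HasDirDerivAt f y (t, h) (0, v) ↔ HasDirDerivAt (fun z => f (t, z)) y h v := by
    intro f y t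
    simp [HasDirDerivAt]
  rw [hvar]
  rcases le_or_gt 0 t with ht | ht
  · have h1 : (fun z : H => seeley α g (t, z)) = fun z => g (t, z) :=
      funext fun z => seeley_of_nonneg (p := (t, z)) ht
    rw [h1, seeley_of_nonneg (p := (t, (h, v))) ht]
    exact hvar.1 (hd' t ht)
  · obtain ⟨N, hN⟩ := exists_reflection_gt c ht
    have heq : EqOn (fun z => ∑ j ∈ Finset.range N, α j • g (-2 ^ j * t, z))
        (fun z => seeley α g (t, z)) W := fun z hz =>
      (seeley_eq_sum (fun r hr => hgc r hr z (hWW' hz)) ht (hN t le_rfl)).symm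
    refine HasDirDerivAt.congr hW hh heq ?_
    rw [seeley_eq_sum (fun r hr => hghc r hr _ ⟨hWW' hh, mem_univ _⟩) ht (hN t le_rfl)]
    refine HasDirDerivAt.sum _ fun j _ => HasDirDerivAt.const_smul _ (hvar.1 (hd' _ ?_))
    have : (0 : ℝ) < 2 ^ j := by positivity
    nlinarith

/-- Derivatives are determined only over `W`; density passes their vanishing on to `W'`. -/
theorem eq_zero_of_continuousOn {Y : Type*} [TopologicalSpace Y] {f : ℝ × Y → F} {c : ℝ}
    (hc0 : 0 ≤ c) {W W' : Set Y} (hWW' : W ⊆ W') (hWc : W' ⊆ closure W)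
    (hf : ContinuousOn f (Ici 0 ×ˢ W')) (h : ∀ s > c, ∀ y ∈ W, f (s, y) = 0) :
    ∀ s > c, ∀ y ∈ W', f (s, y) = 0 := by
  have h1 : EqOn f (fun _ => 0) (Ioi c ×ˢ W) := fun p hp => h p.1 hp.1 p.2 hp.2
  have h2 : EqOn f (fun _ => 0) (Ioi c ×ˢ W') := by
    refine h1.of_subset_closure (hf.mono (prod_mono_left fun s hs => ?_)) continuousOn_const
      (prod_mono_right hWW') ?_
    · exact mem_Ici.2 (hc0.trans (le_of_lt hs))
    · rw [closure_prod_eq]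
      exact prod_mono subset_closure hWc
  exact fun s hs y hy => h2 ⟨hs, hy⟩

/-- Seeley's extension operator preserves differentiability. -/
theorem PCk.seeley {a : ℕ → ℝ}
    (ha : ∀ p : ℕ, Summable (fun j => |a j * (-2 ^ j) ^ p|) ∧
      HasSum (fun j => a j * (-2 ^ j) ^ p) 1)
    {c : ℝ} (hc0 : 0 ≤ c) {n : ℕ} {g : ℝ × H → F} {W W' : Set H} (hW : IsOpen W) (hWW' : W ⊆ W')
    (hWc : W' ⊆ closure W) (hg : PCk n g (Ioi 0) (Ici 0) W W')
    (hgc : ∀ s > c, ∀ y ∈ W', g (s, y) = 0) (p : ℕ) :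
    PCk n (seeley (fun j => a j * (-2 ^ j) ^ p) g) univ univ W W' := by
  induction n generalizing H p with
  | zero => exact continuousOn_seeley (ha p).1 (ha p).2 hg hc0 hgc
  | succ n ih =>
    obtain ⟨hcont, gt, gh, h1, h2, h3, h4⟩ := hg
    have hopen : IsOpen (Ioi c ×ˢ W) := isOpen_Ioi.prod hW
    have hzero : ∀ {y : F} {s : ℝ} {x : H} {d : ℝ × H}, s > c → x ∈ W →
        HasDirDerivAt g y (s, x) d → y = 0 := by
      intro y s x d hs hx hd
      have hz : HasDirDerivAt g 0 (s, x) d :=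
        (hasDirDerivAt_const (0 : F) (s, x) d).congr hopen ⟨hs, hx⟩
          fun q hq => (hgc q.1 hq.1 q.2 (hWW' hq.2)).symm
      exact hd.unique hz
    have hgtc : ∀ s > c, ∀ y ∈ W', gt (s, y) = 0 :=
      eq_zero_of_continuousOn hc0 hWW' hWc h3.continuousOn fun s hs y hy =>
        hzero hs hy (h1 s (hc0.trans_lt hs) y hy)
    have hghc : ∀ s > c, ∀ y ∈ W' ×ˢ (univ : Set H), gh (s, y) = 0 :=
      eq_zero_of_continuousOn hc0 (prod_mono_left hWW')
        (by rw [closure_prod_eq, closure_univ]; exact prod_mono_left hWc) h4.continuousOn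
        fun s hs y hy => hzero hs hy.1 (h2 s (hc0.trans_lt hs) y.1 hy.1 y.2)
    -- The time derivative raises the moment index `p` by one, which is why the induction runs over
    -- all `p` at once.
    refine ⟨continuousOn_seeley (ha p).1 (ha p).2 hcont hc0 hgc,
      Bastiani.seeley (fun j => a j * (-2 ^ j) ^ (p + 1)) gt,
      Bastiani.seeley (fun j => a j * (-2 ^ j) ^ p) gh, fun t _ h hh => ?_, fun t _ h hh v => ?_,
      ih hW hWW' hWc h3 hgtc (p + 1),
      ih (hW.prod isOpen_univ) (prod_mono_left hWW')
        (by rw [closure_prod_eq, closure_univ]; exact prod_mono_left hWc) h4 hghc p⟩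
    · exact hasDirDerivAt_seeley_time (fun j => by ring) (ha p).1 (ha p).2 (ha (p + 1)).1
        (ha (p + 1)).2 hWW' hcont h3.continuousOn hc0 hgc hgtc h1 t hh
    · exact hasDirDerivAt_seeley_space hW hWW' hcont h4.continuousOn hgc hghc h2 t hh v

end SeeleyDeriv

/-! ### Locality, and extended differentials as maps on the whole space -/

section Local

variable {H : Type u} {F : Type v}
  [AddCommGroup H] [Module ℝ H] [TopologicalSpace H]
  [IsTopologicalAddGroup H] [ContinuousSMul ℝ H]
  [AddCommGroup F] [Module ℝ F] [TopologicalSpace F]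
  [IsTopologicalAddGroup F] [ContinuousSMul ℝ F] [LocallyConvexSpace ℝ F] [T2Space F]

/-- The quotients agree near `0`, so even the default values agree and no differentiability is
required. -/
theorem dirDeriv_congr {f g : H → F} {U : Set H} (hU : IsOpen U) (hfg : EqOn f g U) {x : H}
    (hx : x ∈ U) (v : H) : dirDeriv f x v = dirDeriv g x v := by
  have hc : Continuous (fun t : ℝ => x + t • v) := by fun_prop
  have hmem : ∀ᶠ t : ℝ in 𝓝[≠] 0, x + t • v ∈ U := by
    apply mem_nhdsWithin_of_mem_nhds
    apply hc.continuousAt.preimage_mem_nhds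
    simpa using hU.mem_nhds hx
  unfold dirDeriv limUnder
  congr 1
  refine Filter.map_congr ?_
  filter_upwards [hmem] with t ht
  rw [hfg ht, hfg hx]

theorem differential_congr {f g : H → F} {U : Set H} (hU : IsOpen U) (hfg : EqOn f g U) (ℓ : ℕ) :
    ∀ (w : Fin ℓ → H), EqOn (fun x => differential f ℓ x w) (fun x => differential g ℓ x w) U := by
  induction ℓ with
  | zero => exact fun w x hx => hfg hx
  | succ ℓ ih => exact fun w x hx => dirDeriv_congr hU (ih (Fin.init w)) hx _

theorem CkOn.congr {k : ℕ∞} {f g : H → F} {U : Set H} (hU : IsOpen U) (hfg : EqOn f g U)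
    (hf : CkOn k f U) : CkOn k g U where
  exists_dirDeriv ℓ hℓ w v x hx := by
    obtain ⟨y, hy⟩ := hf.exists_dirDeriv ℓ hℓ w v x hx
    exact ⟨y, hy.congr hU hx (differential_congr hU hfg ℓ w)⟩
  continuousOn ℓ hℓ := (hf.continuousOn ℓ hℓ).congr fun p hp =>
    (differential_congr hU hfg ℓ p.2 hp.1).symm

theorem zeroExt_of_mem {U : Set H} (f : U → F) {x : H} (hx : x ∈ U) : zeroExt f x = f ⟨x, hx⟩ :=
  Subtype.val_injective.extend_apply f 0 ⟨x, hx⟩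

/-- Membership in `𝒞^k_{U'}(U, F)` is a local property. -/
theorem memCkExt_of_local {k : ℕ∞} {U U' : Set H} (hU : IsPair U U') {g : H → F}
    (h : ∀ x ∈ U', ∃ O : Set H, IsOpen O ∧ x ∈ O ∧ ∃ g' : H → F, EqOn g g' (U ∩ O) ∧
      ∀ n : ℕ, (n : ℕ∞) ≤ k → TCk n g' (U ∩ O) (U' ∩ O)) :
    MemCkExt k U U' (fun x : U => g x) := by
  set f := zeroExt (fun x : U => g x) with hf
  have hfg : EqOn f g U := fun x hx => zeroExt_of_mem _ hx
  have hck : ∀ x ∈ U, ∃ O : Set H, IsOpen O ∧ x ∈ O ∧ CkOn k f (U ∩ O) := by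
    intro x hx
    obtain ⟨O, hO, hxO, g', hg', ht⟩ := h x (hU.subset hx)
    have hUO := hU.isOpen.inter hO
    exact ⟨O, hO, hxO, (TCk.ckOn hUO (inter_subset_inter_left _ hU.subset) ht).congr hUO
      fun y hy => ((hfg hy.1).trans (hg' hy)).symm⟩
  have hckOn : CkOn k f U := by
    refine ⟨fun ℓ hℓ w v x hx => ?_, fun ℓ hℓ => ?_⟩
    · obtain ⟨O, hO, hxO, hc⟩ := hck x hx
      exact hc.exists_dirDeriv ℓ hℓ w v x ⟨hx, hxO⟩
    · rintro ⟨x, w⟩ ⟨hx, -⟩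
      obtain ⟨O, hO, hxO, hc⟩ := hck x hx
      exact ((hc.continuousOn ℓ hℓ).continuousAt
        (((hU.isOpen.inter hO).prod isOpen_univ).mem_nhds
          ⟨⟨hx, hxO⟩, mem_univ _⟩)).continuousWithinAt
  refine ⟨hckOn, fun ℓ hℓ => ?_⟩
  -- `extendFrom` is one global candidate; its continuity only requires limits at points of `U'`,
  -- which the local models supply.
  have hcont : ContinuousOn (extendFrom (U ×ˢ (univ : Set (Fin ℓ → H)))
      fun p => differential f ℓ p.1 p.2) (U' ×ˢ univ) := by
    refine continuousOn_extendFrom ?_ ?_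
    · rw [closure_prod_eq, closure_univ]
      exact prod_mono_left hU.subset_closure
    · rintro ⟨x, w⟩ ⟨hx, -⟩
      obtain ⟨O, hO, hxO, g', hg', ht⟩ := h x hx
      have hUO := hU.isOpen.inter hO
      obtain ⟨Ψ, hΨ, hΨf⟩ := (ht ℓ hℓ).exists_differential hUO
        (inter_subset_inter_left _ hU.subset) ℓ 0 rfl
      refine ⟨Ψ (x, w), ?_⟩
      have h1 : Tendsto Ψ (𝓝[(U ∩ O) ×ˢ univ] (x, w)) (𝓝 (Ψ (x, w))) :=
        (hΨ.continuousOn (x, w) ⟨⟨hx, hxO⟩, mem_univ _⟩).mono_left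
          (nhdsWithin_mono _ (prod_mono_left (inter_subset_inter_left _ hU.subset)))
      have h2 : (U ∩ O) ×ˢ (univ : Set (Fin ℓ → H)) = (U ×ˢ univ) ∩ (O ×ˢ univ) := by
        rw [prod_inter_prod, inter_univ]
      have h3 : 𝓝[(U ∩ O) ×ˢ (univ : Set (Fin ℓ → H))] (x, w) = 𝓝[U ×ˢ univ] (x, w) := by
        rw [h2]
        exact nhdsWithin_inter_of_mem'
          (mem_nhdsWithin_of_mem_nhds ((hO.prod isOpen_univ).mem_nhds ⟨hxO, mem_univ _⟩))
      rw [h3] at h1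
      refine h1.congr' ?_
      rw [← h3]
      filter_upwards [self_mem_nhdsWithin] with p hp
      rw [hΨf p.1 hp.1 p.2]
      exact (differential_congr hUO (fun y hy => (hfg hy.1).trans (hg' hy)) ℓ p.2 hp.1).symm
  refine ⟨fun p => extendFrom (U ×ˢ univ) (fun p => differential f ℓ p.1 p.2) (p.1, p.2),
    hcont.comp_continuous (by fun_prop) fun p => ⟨p.1.2, mem_univ _⟩, fun x hx hx' w => ?_⟩
  exact extendFrom_extends (hckOn.continuousOn ℓ hℓ) (x, w) ⟨hx, mem_univ _⟩

variable {k : ℕ∞} {U U' : Set H} {hU : IsOpen U}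

open Classical in
/-- The extension by zero of `extDifferential f ℓ` to the whole space. -/
def extTotal (f : CkExt (F := F) k hU U') (ℓ : ℕ) (p : H × (Fin ℓ → H)) : F :=
  if h : p.1 ∈ U' ∧ (ℓ : ℕ∞) ≤ k then extDifferential f ℓ h.2 (⟨p.1, h.1⟩, p.2) else 0

theorem extTotal_of_mem (f : CkExt (F := F) k hU U') {ℓ : ℕ} (hℓ : (ℓ : ℕ∞) ≤ k) {x : H}
    (hx : x ∈ U') (w : Fin ℓ → H) :
    extTotal f ℓ (x, w) = extDifferential f ℓ hℓ (⟨x, hx⟩, w) :=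
  dif_pos (c := x ∈ U' ∧ (ℓ : ℕ∞) ≤ k) ⟨hx, hℓ⟩

theorem continuousOn_extTotal (f : CkExt (F := F) k hU U') {ℓ : ℕ} (hℓ : (ℓ : ℕ∞) ≤ k) :
    ContinuousOn (extTotal f ℓ) (U' ×ˢ univ) := by
  rw [continuousOn_iff_continuous_domRestrict]
  have h := (isExtDifferential_extDifferential f ℓ hℓ).continuous
  refine (h.comp (f := fun p : U' ×ˢ (univ : Set (Fin ℓ → H)) =>
    ((⟨p.1.1, p.2.1⟩ : U'), p.1.2)) (by fun_prop)).congr ?_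
  rintro ⟨⟨x, w⟩, hx, -⟩
  exact (extTotal_of_mem f hℓ hx w).symm

theorem extTotal_eq_differential (f : CkExt (F := F) k hU U') (hUU' : U ⊆ U') {ℓ : ℕ}
    (hℓ : (ℓ : ℕ∞) ≤ k) {x : H} (hx : x ∈ U) (w : Fin ℓ → H) :
    extTotal f ℓ (x, w) = differential (zeroExt (f : U → F)) ℓ x w := by
  rw [extTotal_of_mem f hℓ (hUU' hx)]
  exact (isExtDifferential_extDifferential f ℓ hℓ).eq_differential x hx _ w

theorem tendsto_differential (f : CkExt (F := F) k hU U') (hUU' : U ⊆ U') {ℓ : ℕ}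
    (hℓ : (ℓ : ℕ∞) ≤ k) {x : H} (hx : x ∈ U') (w : Fin ℓ → H) :
    Tendsto (fun y => differential (zeroExt (f : U → F)) ℓ y w) (𝓝[U] x)
      (𝓝 (extDifferential f ℓ hℓ (⟨x, hx⟩, w))) := by
  rw [← extTotal_of_mem f hℓ hx w]
  have h1 : ContinuousOn (fun y => extTotal f ℓ (y, w)) U' :=
    (continuousOn_extTotal f hℓ).comp (by fun_prop) fun y hy => ⟨hy, mem_univ _⟩
  refine ((h1 x hx).mono_left (nhdsWithin_mono _ hUU')).congr' ?_
  filter_upwards [self_mem_nhdsWithin] with y hy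
  exact extTotal_eq_differential f hUU' hℓ hy w

/-- The continuous extension of `f` to `U'`, extended by zero to the whole space. -/
def extFun (f : CkExt (F := F) k hU U') (x : H) : F := extTotal f 0 (x, 0)

theorem tCk_extFun (f : CkExt (F := F) k hU U') (hUU' : U ⊆ U') {n : ℕ} (hn : (n : ℕ∞) ≤ k) :
    TCk n (extFun f) U U' := by
  have h := CkOn.tCk hU hUU' f.2.ckOn (Ψ := extTotal f) (fun ℓ hℓ => continuousOn_extTotal f hℓ)
    (fun ℓ hℓ x hx w => extTotal_eq_differential f hUU' hℓ hx w) n 0 (by simpa using hn)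
  exact TCk.comp (g := fun x : H => (x, (0 : Fin 0 → H))) (hU.prod isOpen_univ)
    (prod_mono_left hUU') h
    (TCk.clm (ContinuousLinearMap.inl ℝ H (Fin 0 → H)) U U') (fun x hx => ⟨hx, mem_univ _⟩)
    (fun x hx => ⟨hx, mem_univ _⟩)

theorem extFun_eq (f : CkExt (F := F) k hU U') (hUU' : U ⊆ U') {x : H} (hx : x ∈ U) :
    extFun f x = (f : U → F) ⟨x, hx⟩ :=
  (extTotal_eq_differential f hUU' (by simp) hx 0).trans (zeroExt_of_mem _ hx)

theorem continuousOn_extFun (f : CkExt (F := F) k hU U') (hUU' : U ⊆ U') :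
    ContinuousOn (extFun f) U' :=
  (tCk_extFun f hUU' (n := 0) (by simp)).continuousOn

theorem extFun_of_notMem (f : CkExt (F := F) k hU U') {x : H} (hx : x ∉ U') : extFun f x = 0 :=
  dif_neg fun h => hx h.1

/-- The chosen extensions are additive because both sides are continuous on `U'` and agree on the
dense subset `U`. -/
theorem extFun_add (f g : CkExt (F := F) k hU U') (hUU' : U ⊆ U') (hUc : U' ⊆ closure U) (x : H) :
    extFun (f + g) x = extFun f x + extFun g x := by
  by_cases hx : x ∈ U'
  · have h : EqOn (extFun (f + g)) (fun x => extFun f x + extFun g x) U := fun x hx => by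
      simp only [extFun_eq _ hUU' hx]
      rfl
    exact h.of_subset_closure (continuousOn_extFun _ hUU')
      ((continuousOn_extFun _ hUU').add (continuousOn_extFun _ hUU')) hUU' hUc hx
  · simp only [extFun_of_notMem _ hx, add_zero]

theorem extFun_smul (c : ℝ) (f : CkExt (F := F) k hU U') (hUU' : U ⊆ U') (hUc : U' ⊆ closure U)
    (x : H) : extFun (c • f) x = c • extFun f x := by
  by_cases hx : x ∈ U'
  · have h : EqOn (extFun (c • f)) (fun x => c • extFun f x) U := fun x hx => by
      simp only [extFun_eq _ hUU' hx]
      rfl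
    exact h.of_subset_closure (continuousOn_extFun _ hUU')
      ((continuousOn_extFun _ hUU').const_smul c) hUU' hUc hx
  · simp only [extFun_of_notMem _ hx, smul_zero]

/-- Both values are limits along `O` of the same differential. The main theorem uses this for the
agreement on the ball and for the vanishing outside. -/
theorem extDifferential_congr {U₁ U₁' : Set H} {hU₁ : IsOpen U₁}
    (f : CkExt (F := F) k hU U') (g : CkExt (F := F) k hU₁ U₁') (hUU' : U ⊆ U')
    (hUU₁' : U₁ ⊆ U₁') {O : Set H} (hO : IsOpen O) (hOU : O ⊆ U) (hOU₁ : O ⊆ U₁)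
    (hfg : EqOn (zeroExt (f : U → F)) (zeroExt (g : U₁ → F)) O) {ℓ : ℕ} (hℓ : (ℓ : ℕ∞) ≤ k)
    {x : H} (hx : x ∈ U') (hx₁ : x ∈ U₁') (hxO : x ∈ closure O) (w : Fin ℓ → H) :
    extDifferential f ℓ hℓ (⟨x, hx⟩, w) = extDifferential g ℓ hℓ (⟨x, hx₁⟩, w) := by
  have := mem_closure_iff_nhdsWithin_neBot.1 hxO
  have h1 := (tendsto_differential f hUU' hℓ hx w).mono_left (nhdsWithin_mono _ hOU)
  have h2 := (tendsto_differential g hUU₁' hℓ hx₁ w).mono_left (nhdsWithin_mono _ hOU₁)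
  refine tendsto_nhds_unique (h1.congr' ?_) h2
  filter_upwards [self_mem_nhdsWithin] with y hy
  exact differential_congr hO hfg ℓ w hy

theorem extDifferential_zero (hUU' : U ⊆ U') (hUc : U' ⊆ closure U) {ℓ : ℕ} (hℓ : (ℓ : ℕ∞) ≤ k)
    {x : H} (hx : x ∈ U') (w : Fin ℓ → H) :
    extDifferential (0 : CkExt (F := F) k hU U') ℓ hℓ (⟨x, hx⟩, w) = 0 := by
  have := mem_closure_iff_nhdsWithin_neBot.1 (hUc hx)
  refine tendsto_nhds_unique (tendsto_differential 0 hUU' hℓ hx w) ?_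
  have h : zeroExt ((0 : CkExt (F := F) k hU U') : U → F) = 0 := zeroExt_zero
  simp only [h, differential_zero]
  exact tendsto_const_nhds

end Local

/-! ### The extension operator -/

section SeeleyLinear

variable {Y F : Type*} [AddCommGroup F] [Module ℝ F] [TopologicalSpace F]
  [IsTopologicalAddGroup F] [ContinuousSMul ℝ F]

theorem seeley_add {α : ℕ → ℝ} {g g' : ℝ × Y → F} {c : ℝ} (hg : ∀ s > c, ∀ y, g (s, y) = 0)
    (hg' : ∀ s > c, ∀ y, g' (s, y) = 0) (p : ℝ × Y) :
    seeley α (fun q => g q + g' q) p = seeley α g p + seeley α g' p := by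
  obtain ⟨t, y⟩ := p
  rcases le_or_gt 0 t with h | h
  · simp only [seeley_of_nonneg (p := (t, y)) h]
  · obtain ⟨N, hN⟩ := exists_reflection_gt c h
    rw [seeley_eq_sum (fun s hs => hg s hs y) h (hN t le_rfl),
      seeley_eq_sum (fun s hs => hg' s hs y) h (hN t le_rfl),
      seeley_eq_sum (c := c) (fun s hs => by simp [hg s hs y, hg' s hs y]) h (hN t le_rfl)]
    simp only [smul_add, Finset.sum_add_distrib]

theorem seeley_smul {α : ℕ → ℝ} {g : ℝ × Y → F} {c : ℝ} (hg : ∀ s > c, ∀ y, g (s, y) = 0)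
    (r : ℝ) (p : ℝ × Y) : seeley α (fun q => r • g q) p = r • seeley α g p := by
  obtain ⟨t, y⟩ := p
  rcases le_or_gt 0 t with h | h
  · simp only [seeley_of_nonneg (p := (t, y)) h]
  · obtain ⟨N, hN⟩ := exists_reflection_gt c h
    rw [seeley_eq_sum (fun s hs => hg s hs y) h (hN t le_rfl),
      seeley_eq_sum (c := c) (fun s hs => by simp [hg s hs y]) h (hN t le_rfl), Finset.smul_sum]
    exact Finset.sum_congr rfl fun j _ => smul_comm _ _ _

end SeeleyLinear

/-- A smooth function on `ℝ`, equal to `1` on `(-∞, c / 2]` and to `0` on `[c, ∞)`. -/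
def cutoff (c t : ℝ) : ℝ := Real.smoothTransition (2 - 2 * t / c)

theorem cutoff_of_le {c t : ℝ} (hc : 0 < c) (ht : t ≤ c / 2) : cutoff c t = 1 := by
  refine Real.smoothTransition.one_of_one_le ?_
  have : 2 * t / c ≤ 1 := by rw [div_le_one hc]; linarith
  linarith

theorem cutoff_of_ge {c t : ℝ} (hc : 0 < c) (ht : c ≤ t) : cutoff c t = 0 := by
  refine Real.smoothTransition.zero_of_nonpos ?_
  have : 2 ≤ 2 * t / c := by rw [le_div_iff₀ hc]; linarith
  linarith

theorem contDiff_cutoff (c : ℝ) {n : ℕ} : ContDiff ℝ n (cutoff c) :=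
  Real.smoothTransition.contDiff.comp (by fun_prop)

section Extension

variable {P : Type u} {E : Type v} {F : Type w}
  [AddCommGroup P] [Module ℝ P] [TopologicalSpace P]
  [AddCommGroup E] [TopologicalSpace E]
  [AddCommGroup F] [Module ℝ F] [TopologicalSpace F]

/-- The map `(t, Z, x) ↦ G (e^{-t} Z / ξ(Z), x)`, cut off at `t = c`. -/
def polar (c : ℝ) (ξ : P → ℝ) (G : P × E → F) (q : ℝ × (P × E)) : F :=
  cutoff c q.1 • G ((Real.exp (-q.1) * (ξ q.2.1)⁻¹) • q.2.1, q.2.2)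

/-- Seeley's extension in the variable `-log ξ`. -/
def radialExt (a : ℕ → ℝ) (c : ℝ) (ξ : P → ℝ) (G : P × E → F) (p : P × E) : F :=
  seeley a (polar c ξ G) (-Real.log (ξ p.1), p)

/-- The extension of `G` from `ξ < 1` to the whole space. -/
def ballExt (a : ℕ → ℝ) (c : ℝ) (ξ : P → ℝ) (G : P × E → F) (p : P × E) : F :=
  if ξ p.1 < 1 then G p else radialExt a c ξ G p

theorem polar_eq_zero {c : ℝ} (hc : 0 < c) (ξ : P → ℝ) (G : P × E → F) :
    ∀ s > c, ∀ y, polar c ξ G (s, y) = 0 := by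
  intro s hs y
  simp [polar, cutoff_of_ge hc hs.le]

theorem polar_add {c : ℝ} {ξ : P → ℝ} (G G' : P × E → F) :
    polar c ξ (fun x => G x + G' x) = fun q => polar c ξ G q + polar c ξ G' q :=
  funext fun _ => smul_add _ _ _

theorem polar_smul {c : ℝ} {ξ : P → ℝ} (r : ℝ) (G : P × E → F) :
    polar c ξ (fun x => r • G x) = fun q => r • polar c ξ G q :=
  funext fun _ => smul_comm _ _ _

variable [IsTopologicalAddGroup F] [ContinuousSMul ℝ F]

theorem ballExt_add {a : ℕ → ℝ} {c : ℝ} (hc : 0 < c) {ξ : P → ℝ} (G G' : P × E → F) (p : P × E) :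
    ballExt a c ξ (fun x => G x + G' x) p = ballExt a c ξ G p + ballExt a c ξ G' p := by
  unfold ballExt radialExt
  split_ifs
  · rfl
  · rw [polar_add, seeley_add (polar_eq_zero hc ξ G) (polar_eq_zero hc ξ G')]

theorem ballExt_smul {a : ℕ → ℝ} {c : ℝ} (hc : 0 < c) {ξ : P → ℝ} (r : ℝ) (G : P × E → F)
    (p : P × E) : ballExt a c ξ (fun x => r • G x) p = r • ballExt a c ξ G p := by
  unfold ballExt radialExt
  split_ifs
  · rfl
  · rw [polar_smul, seeley_smul (polar_eq_zero hc ξ G)]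

theorem ballExt_of_lt {a : ℕ → ℝ} {c : ℝ} {ξ : P → ℝ} (G : P × E → F) {p : P × E}
    (hp : ξ p.1 < 1) : ballExt a c ξ G p = G p := if_pos hp

/-- Every reflected time `2^j log ξ` already exceeds `c`, so the sum is empty (`N = 0`). -/
theorem ballExt_of_exp_lt {a : ℕ → ℝ} {c : ℝ} (hc : 0 < c) {ξ : P → ℝ} (G : P × E → F) {p : P × E}
    (hp : Real.exp c < ξ p.1) : ballExt a c ξ G p = 0 := by
  have hlog : c < Real.log (ξ p.1) := (Real.lt_log_iff_exp_lt ((Real.exp_pos c).trans hp)).2 hp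
  have h1 : ¬ ξ p.1 < 1 := not_lt.2 ((Real.one_le_exp hc.le).trans hp.le)
  rw [ballExt, if_neg h1, radialExt, seeley_eq_sum (N := 0) (c := c)
    (fun s hs => polar_eq_zero hc ξ G s hs p) (by linarith)]
  · simp
  · intro j _
    have : (1 : ℝ) ≤ 2 ^ j := one_le_pow₀ (by norm_num)
    nlinarith

/-- Near the sphere `ξ = 1`, the extension is given by Seeley's formula on both sides. -/
theorem ballExt_eq_radialExt {a : ℕ → ℝ} {c : ℝ} (hc : 0 < c) {ξ : P → ℝ} (G : P × E → F)
    {p : P × E} (hp : Real.exp (-(c / 2)) < ξ p.1) :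
    ballExt a c ξ G p = radialExt a c ξ G p := by
  have hpos := (Real.exp_pos _).trans hp
  unfold ballExt
  split_ifs with h
  swap
  · rfl
  have h1 : -(c / 2) < Real.log (ξ p.1) := (Real.lt_log_iff_exp_lt hpos).2 hp
  have h2 : Real.log (ξ p.1) < 0 := Real.log_neg hpos h
  rw [radialExt, seeley_of_nonneg (by simp only; linarith), polar,
    cutoff_of_le hc (by simp only; linarith), neg_neg, Real.exp_log hpos,
    mul_inv_cancel₀ hpos.ne', one_smul, one_smul]

end Extension

theorem tCk_comp_contDiffOn {P : Type u} [AddCommGroup P] [Module ℝ P] [TopologicalSpace P]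
    [IsTopologicalAddGroup P] [ContinuousSMul ℝ P] {n : ℕ} {f : ℝ → ℝ} {g : P → ℝ} {I : Set ℝ}
    {U U' : Set P} (hI : IsOpen I) (hf : ContDiffOn ℝ n f I) (hg : TCk n g U U') (hU : MapsTo g U I)
    (hU' : MapsTo g U' I) : TCk n (fun x => f (g x)) U U' :=
  (tCk_of_contDiffOn hI hf).comp hI subset_rfl hg hU hU'

/-! ### Regularity of the extension from the ball. -/

section Regularity

variable {P : Type u} {E : Type v} {F : Type w}
  [AddCommGroup P] [Module ℝ P] [TopologicalSpace P]
  [IsTopologicalAddGroup P] [ContinuousSMul ℝ P] [LocallyConvexSpace ℝ P] [T2Space P]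
  [AddCommGroup E] [Module ℝ E] [TopologicalSpace E]
  [IsTopologicalAddGroup E] [ContinuousSMul ℝ E] [LocallyConvexSpace ℝ E]
  [AddCommGroup F] [Module ℝ F] [TopologicalSpace F]
  [IsTopologicalAddGroup F] [ContinuousSMul ℝ F] [LocallyConvexSpace ℝ F] [T2Space F]

theorem CkOn.tCk_self {k : ℕ∞} {f : P → F} {U : Set P} (hU : IsOpen U) (hf : CkOn k f U) {n : ℕ}
    (hn : (n : ℕ∞) ≤ k) : TCk n f U U := by
  have h := CkOn.tCk hU subset_rfl hf (Ψ := fun ℓ p => differential f ℓ p.1 p.2)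
    hf.continuousOn (fun _ _ _ _ _ => rfl) n 0 (by simpa using hn)
  exact TCk.comp (g := fun x : P => (x, (0 : Fin 0 → P))) (hU.prod isOpen_univ) subset_rfl h
    (TCk.clm (ContinuousLinearMap.inl ℝ P (Fin 0 → P)) U U) (fun x hx => ⟨hx, mem_univ _⟩)
    (fun x hx => ⟨hx, mem_univ _⟩)

variable {k : ℕ∞} {ξ : P → ℝ}

theorem IsDistanceLike.pos (hξ : IsDistanceLike k ξ) {Z : P} (hZ : Z ≠ 0) : 0 < ξ Z :=
  lt_of_le_of_ne (hξ.nonneg Z) fun h => hZ ((hξ.eq_zero_iff Z).1 h.symm)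

theorem IsDistanceLike.polar_apply (hξ : IsDistanceLike k ξ) {Z : P} (hZ : Z ≠ 0) (t : ℝ) :
    ξ ((Real.exp (-t) * (ξ Z)⁻¹) • Z) = Real.exp (-t) := by
  have h := hξ.pos hZ
  rw [hξ.homogeneous _ (by positivity), mul_assoc, inv_mul_cancel₀ h.ne', mul_one]

/-- Chain rule: by homogeneity the rescaled point has `ξ = e^{-t}`, so `t > 0` lands in the open
ball and `t ≥ 0` in the closed one. -/
theorem IsDistanceLike.tCk_polar (hξ : IsDistanceLike k ξ) (c : ℝ) {V V' : Set E} (hV : IsOpen V)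
    (hVV' : V ⊆ V') {G : P × E → F} {n : ℕ} (hn : (n : ℕ∞) ≤ k)
    (hG : TCk n G ((ξ ⁻¹' Ico 0 1) ×ˢ V) ((ξ ⁻¹' Icc 0 1) ×ˢ V')) :
    TCk n (polar c ξ G) (Ioi 0 ×ˢ ({0}ᶜ ×ˢ V)) (Ici 0 ×ˢ ({0}ᶜ ×ˢ V')) := by
  set A : Set (ℝ × (P × E)) := Ioi 0 ×ˢ ({0}ᶜ ×ˢ V)
  set A' : Set (ℝ × (P × E)) := Ici 0 ×ˢ ({0}ᶜ ×ˢ V')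
  have ht : TCk n (fun q : ℝ × (P × E) => q.1) A A' :=
    TCk.clm (ContinuousLinearMap.fst ℝ ℝ (P × E)) _ _
  have hZ : TCk n (fun q : ℝ × (P × E) => q.2.1) A A' :=
    TCk.clm ((ContinuousLinearMap.fst ℝ P E).comp (ContinuousLinearMap.snd ℝ ℝ (P × E))) _ _
  have hx : TCk n (fun q : ℝ × (P × E) => q.2.2) A A' :=
    TCk.clm ((ContinuousLinearMap.snd ℝ P E).comp (ContinuousLinearMap.snd ℝ ℝ (P × E))) _ _
  have h0 : IsOpen ({0}ᶜ : Set P) := isOpen_compl_singleton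
  have hξZ : TCk n (fun q : ℝ × (P × E) => ξ q.2.1) A A' :=
    (hξ.ckOn.tCk_self h0 hn).comp h0 subset_rfl hZ (fun q hq => hq.2.1) (fun q hq => hq.2.1)
  have hinv : TCk n (fun q : ℝ × (P × E) => (ξ q.2.1)⁻¹) A A' :=
    tCk_comp_contDiffOn isOpen_Ioi (contDiffOn_inv ℝ |>.mono fun s hs => ne_of_gt hs) hξZ
      (I := Ioi 0) (fun q hq => hξ.pos hq.2.1) (fun q hq => hξ.pos hq.2.1)
  have hexp : TCk n (fun q : ℝ × (P × E) => Real.exp (-q.1)) A A' :=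
    tCk_comp_contDiffOn (f := fun t => Real.exp (-t)) isOpen_univ
      (Real.contDiff_exp.comp contDiff_neg).contDiffOn ht (mapsTo_univ _ _) (mapsTo_univ _ _)
  have hcut : TCk n (fun q : ℝ × (P × E) => cutoff c q.1) A A' :=
    tCk_comp_contDiffOn isOpen_univ (contDiff_cutoff c).contDiffOn ht (mapsTo_univ _ _)
      (mapsTo_univ _ _)
  have hinner : TCk n (fun q : ℝ × (P × E) =>
      ((Real.exp (-q.1) * (ξ q.2.1)⁻¹) • q.2.1, q.2.2)) A A' :=
    ((hexp.smul hinv).smul hZ).prodMk hx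
  refine hcut.smul (hG.comp (hξ.isOpen_prod hV) (prod_mono (preimage_mono Ico_subset_Icc_self) hVV')
    hinner ?_ ?_)
  · rintro ⟨t, Z, x⟩ ⟨ht, hZ, hx⟩
    refine ⟨?_, hx⟩
    rw [mem_preimage, hξ.polar_apply hZ]
    exact ⟨(Real.exp_pos _).le, Real.exp_lt_one_iff.2 (by simpa using ht)⟩
  · rintro ⟨t, Z, x⟩ ⟨ht, hZ, hx⟩
    refine ⟨?_, hx⟩
    rw [mem_preimage, hξ.polar_apply hZ]
    exact ⟨(Real.exp_pos _).le, Real.exp_le_one_iff.2 (by simpa using ht)⟩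

theorem IsDistanceLike.tCk_radialExt (hξ : IsDistanceLike k ξ) {a : ℕ → ℝ}
    (ha : ∀ p : ℕ, Summable (fun j => |a j * (-2 ^ j) ^ p|) ∧
      HasSum (fun j => a j * (-2 ^ j) ^ p) 1) {c : ℝ} (hc : 0 < c) {V V' : Set E}
    (hV : IsPair V V') {G : P × E → F} {n : ℕ} (hn : (n : ℕ∞) ≤ k)
    (hG : TCk n G ((ξ ⁻¹' Ico 0 1) ×ˢ V) ((ξ ⁻¹' Icc 0 1) ×ˢ V')) :
    TCk n (radialExt a c ξ G) ({0}ᶜ ×ˢ V) ({0}ᶜ ×ˢ V') := by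
  have h0 : IsOpen ({0}ᶜ : Set P) := isOpen_compl_singleton
  have hW : IsOpen (({0}ᶜ : Set P) ×ˢ V) := h0.prod hV.isOpen
  have hWW' : ({0}ᶜ : Set P) ×ˢ V ⊆ {0}ᶜ ×ˢ V' := prod_mono_right hV.subset
  have h1 := (hξ.tCk_polar c hV.isOpen hV.subset hn hG).pCk isOpen_Ioi Ioi_subset_Ici_self hW hWW'
  have h2 := h1.seeley ha hc.le hW hWW'
    (by rw [closure_prod_eq]; exact prod_mono subset_closure hV.subset_closure)
    (fun s hs y _ => polar_eq_zero hc ξ G s hs y) 0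
  simp only [pow_zero, mul_one] at h2
  have h3 := h2.tCk isOpen_univ subset_rfl hW hWW'
  have hZ : TCk n (fun p : P × E => p.1) (({0}ᶜ : Set P) ×ˢ V) ({0}ᶜ ×ˢ V') :=
    TCk.clm (ContinuousLinearMap.fst ℝ P E) _ _
  have hlog : TCk n (fun p : P × E => -Real.log (ξ p.1)) (({0}ᶜ : Set P) ×ˢ V) ({0}ᶜ ×ˢ V') :=
    tCk_comp_contDiffOn (f := fun s => -Real.log s) isOpen_compl_singleton
      (Real.contDiffOn_log.neg) ((hξ.ckOn.tCk_self h0 hn).comp h0 subset_rfl hZ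
        (fun p hp => hp.1) (fun p hp => hp.1)) (fun p hp => (hξ.pos hp.1).ne')
      (fun p hp => (hξ.pos hp.1).ne')
  exact TCk.comp (f := seeley a (polar c ξ G)) (g := fun p : P × E => (-Real.log (ξ p.1), p))
    (isOpen_univ.prod hW) (prod_mono_right hWW') h3
    (hlog.prodMk (TCk.clm (ContinuousLinearMap.id ℝ (P × E)) _ _))
    (fun p hp => ⟨mem_univ _, hp⟩) (fun p hp => ⟨mem_univ _, hp⟩)

theorem IsPair.univ_prod {V V' : Set E} (hV : IsPair V V') :
    IsPair ((univ : Set P) ×ˢ V) (univ ×ˢ V') where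
  nonempty := univ_nonempty.prod hV.nonempty
  isOpen := isOpen_univ.prod hV.isOpen
  subset := prod_mono_right hV.subset
  subset_closure := by
    rw [closure_prod_eq, closure_univ]
    exact prod_mono_right hV.subset_closure

/-- Two open sets cover the space: `ξ < 1`, where the extension is `G` and the origin causes no
trouble, and `ξ > e^{-c/2}`, where the cutoff is `1` on the ball side and Seeley's formula applies
throughout. -/
theorem IsDistanceLike.memCkExt_ballExt (hξ : IsDistanceLike k ξ) {a : ℕ → ℝ}
    (ha : ∀ p : ℕ, Summable (fun j => |a j * (-2 ^ j) ^ p|) ∧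
      HasSum (fun j => a j * (-2 ^ j) ^ p) 1) {c : ℝ} (hc : 0 < c) {V V' : Set E}
    (hV : IsPair V V') {G : P × E → F} (hG : ∀ n : ℕ, (n : ℕ∞) ≤ k →
      TCk n G ((ξ ⁻¹' Ico 0 1) ×ˢ V) ((ξ ⁻¹' Icc 0 1) ×ˢ V')) :
    MemCkExt k ((univ : Set P) ×ˢ V) (univ ×ˢ V') (fun p => ballExt a c ξ G p) := by
  refine memCkExt_of_local hV.univ_prod fun p hp => ?_
  have hcont : Continuous fun p : P × E => ξ p.1 := hξ.continuous.comp continuous_fst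
  rcases lt_or_ge (ξ p.1) 1 with h | h
  · refine ⟨{p | ξ p.1 < 1}, isOpen_lt hcont continuous_const, h, G,
      fun q hq => ballExt_of_lt G hq.2, fun n hn => (hG n hn).mono ?_ ?_⟩
    · exact fun q hq => ⟨⟨hξ.nonneg _, hq.2⟩, hq.1.2⟩
    · exact fun q hq => ⟨⟨hξ.nonneg _, le_of_lt hq.2⟩, hq.1.2⟩
  · have hne : ∀ q : P × E, Real.exp (-(c / 2)) < ξ q.1 → q.1 ≠ 0 := by
      intro q hq h0
      rw [(hξ.eq_zero_iff _).2 h0] at hq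
      exact lt_asymm hq (Real.exp_pos _)
    refine ⟨{p | Real.exp (-(c / 2)) < ξ p.1}, isOpen_lt continuous_const hcont,
      (Real.exp_lt_one_iff.2 (by linarith)).trans_le h, radialExt a c ξ G,
      fun q hq => ballExt_eq_radialExt hc G hq.2,
      fun n hn => (hξ.tCk_radialExt ha hc hV hn (hG n hn)).mono ?_ ?_⟩
    · exact fun q hq => ⟨hne q hq.2, hq.1.2⟩
    · exact fun q hq => ⟨hne q hq.2, hq.1.2⟩

/-- A point of the closed ball is the limit of `r • Z` as `r ↑ 1`, and homogeneity puts these in the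
open ball. -/
theorem IsDistanceLike.isPair_prod (hξ : IsDistanceLike k ξ) {V V' : Set E} (hV : IsPair V V') :
    IsPair ((ξ ⁻¹' Ico 0 1) ×ˢ V) ((ξ ⁻¹' Icc 0 1) ×ˢ V') where
  nonempty := Set.Nonempty.prod ⟨0, by simp [(hξ.eq_zero_iff 0).2 rfl]⟩ hV.nonempty
  isOpen := hξ.isOpen_prod hV.isOpen
  subset := prod_mono (preimage_mono Ico_subset_Icc_self) hV.subset
  subset_closure := by
    rw [closure_prod_eq]
    refine prod_mono (fun Z hZ => ?_) hV.subset_closure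
    have hc : Continuous fun r : ℝ => r • Z := by fun_prop
    have ht : Tendsto (fun r : ℝ => r • Z) (𝓝[<] 1) (𝓝 Z) := by
      simpa using (hc.tendsto 1).mono_left nhdsWithin_le_nhds
    refine mem_closure_of_tendsto ht ?_
    filter_upwards [self_mem_nhdsWithin,
      mem_nhdsWithin_of_mem_nhds (isOpen_Ioi.mem_nhds (zero_lt_one' ℝ))] with r hr hr0
    have hr0 : 0 < r := hr0
    have hr : r < 1 := hr
    refine ⟨hξ.nonneg _, ?_⟩
    rw [hξ.homogeneous r hr0.le]
    nlinarith [hZ.1, hZ.2]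

end Regularity

/-! ### The norm of a pre-Hilbert space -/

/-- If `⟨x, v⟩ ≥ 0`, the path leaves outwards along `x` and adding `s • v` keeps the norm above `1`;
otherwise it goes inwards and small `s` keep the norm below `1`. -/
theorem isHarmonic_sphere (X : Type*) [NormedAddCommGroup X] [InnerProductSpace ℝ X] :
    IsHarmonic univ ((fun Z : X => ‖Z‖) ⁻¹' {1}) where
  subset := subset_univ _
  isClosed := (isClosed_singleton.preimage continuous_norm).preimage continuous_subtype_val
  exists_path x hx v := by
    have hx : ‖x‖ = 1 := hx
    have key : ∀ r s : ℝ, ‖r • x + s • v‖ ^ 2 = r ^ 2 + 2 * (r * s) * inner ℝ x v +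
        s ^ 2 * ‖v‖ ^ 2 := by
      intro r s
      rw [norm_add_sq_real, norm_smul, norm_smul, inner_smul_left, inner_smul_right, hx, mul_one,
        Real.norm_eq_abs, Real.norm_eq_abs, mul_pow, sq_abs, sq_abs]
      simp only [conj_trivial]
      ring
    have hpath : ∀ t b s : ℝ, x + t • b • x + s • v = (1 + t * b) • x + s • v := by
      intro t b s
      module
    rcases le_or_gt 0 (inner ℝ x v) with h | h
    · refine ⟨1, one_pos, fun t => t • (1 : ℝ) • x, by fun_prop, by simp, fun t ht s hs => ?_⟩
      refine ⟨mem_univ _, fun h1 => ?_⟩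
      have h1 : ‖x + t • (1 : ℝ) • x + s • v‖ = 1 := h1
      have h2 := key (1 + t * 1) s
      rw [← hpath, h1] at h2
      have h3 : 0 ≤ 2 * ((1 + t * 1) * s) * inner ℝ x v :=
        mul_nonneg (mul_nonneg two_pos.le (mul_nonneg (by linarith [ht.1]) hs.1)) h
      have h4 : 0 ≤ s ^ 2 * ‖v‖ ^ 2 := by positivity
      nlinarith [ht.1]
    -- The factor `1 / 2` keeps the coefficient of `x` at least `1 / 2`, and this `δ` lets the
    -- negative linear term in `s` absorb `s² ‖v‖²`.
    · refine ⟨-inner ℝ x v / (‖v‖ ^ 2 + 1), by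
        have : 0 < -inner ℝ x v := by linarith
        positivity, fun t => t • (-(1 / 2) : ℝ) • x, by fun_prop, by simp, fun t ht s hs => ?_⟩
      refine ⟨mem_univ _, fun h1 => ?_⟩
      have h1 : ‖x + t • (-(1 / 2) : ℝ) • x + s • v‖ = 1 := h1
      have h2 := key (1 + t * -(1 / 2)) s
      rw [← hpath, h1] at h2
      have hs2 : s * (‖v‖ ^ 2 + 1) ≤ -inner ℝ x v := by
        have := hs.2
        rwa [le_div_iff₀ (by positivity)] at this
      have h3 : 2 * (1 + t * -(1 / 2)) * inner ℝ x v ≤ inner ℝ x v := by nlinarith [ht.2]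
      have h4 : s * (2 * (1 + t * -(1 / 2)) * inner ℝ x v + s * ‖v‖ ^ 2) ≤ 0 :=
        mul_nonpos_of_nonneg_of_nonpos hs.1 (by nlinarith [hs.1])
      nlinarith [ht.1, ht.2]

theorem isDistanceLike_norm (k : ℕ∞) (X : Type*) [NormedAddCommGroup X] [InnerProductSpace ℝ X] :
    IsDistanceLike k (fun Z : X => ‖Z‖) where
  nonneg := norm_nonneg
  continuous := continuous_norm
  ckOn := TCk.ckOn isOpen_compl_singleton subset_rfl fun _ _ =>
    tCk_of_contDiffOn isOpen_compl_singleton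
      fun _ hx => (contDiffAt_norm ℝ hx).contDiffWithinAt
  eq_zero_iff _ := norm_eq_zero
  homogeneous c hc Z := by rw [norm_smul, Real.norm_of_nonneg hc]
  harmonic := isHarmonic_sphere X

end Bastiani

end

theorem mainTheorem3 (k : ℕ∞) :
    (∀ (P : Type*) [AddCommGroup P] [Module ℝ P] [TopologicalSpace P] [IsTopologicalAddGroup P]
        [ContinuousSMul ℝ P] [LocallyConvexSpace ℝ P] [T2Space P]
        (E : Type*) [AddCommGroup E] [Module ℝ E] [TopologicalSpace E] [IsTopologicalAddGroup E]
        [ContinuousSMul ℝ E] [LocallyConvexSpace ℝ E] [T2Space E]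
        (F : Type*) [AddCommGroup F] [Module ℝ F] [TopologicalSpace F] [IsTopologicalAddGroup F]
        [ContinuousSMul ℝ F] [LocallyConvexSpace ℝ F] [T2Space F]
        (V V' : Set E) (hV : Bastiani.IsPair V V') (τ : ℝ) (_ : 0 < τ) (_ : τ < 1)
        (ξ : P → ℝ) (hξ : Bastiani.IsDistanceLike k ξ),
      ∃ Ext : Bastiani.CkExt (F := F) k (hξ.isOpen_prod hV.isOpen) ((ξ ⁻¹' Icc 0 1) ×ˢ V') →ₗ[ℝ]
          Bastiani.CkExt (F := F) k (isOpen_univ.prod hV.isOpen) ((univ : Set P) ×ˢ V'),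
        ∀ (f : Bastiani.CkExt (F := F) k (hξ.isOpen_prod hV.isOpen) ((ξ ⁻¹' Icc 0 1) ×ˢ V'))
          (ℓ : ℕ) (hℓ : (ℓ : ℕ∞) ≤ k),
          (∀ (Z : P) (x : E) (hZ : Z ∈ ξ ⁻¹' Icc 0 1) (hx : x ∈ V') (w : Fin ℓ → P × E),
            Bastiani.extDifferential (Ext f) ℓ hℓ (⟨(Z, x), mem_univ Z, hx⟩, w) =
              Bastiani.extDifferential f ℓ hℓ (⟨(Z, x), hZ, hx⟩, w)) ∧
          (∀ (Z : P) (x : E) (_ : Z ∈ ξ ⁻¹' Ici (1 + τ)) (hx : x ∈ V') (w : Fin ℓ → P × E),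
            Bastiani.extDifferential (Ext f) ℓ hℓ (⟨(Z, x), mem_univ Z, hx⟩, w) = 0)) ∧
    (∀ (X : Type*) [NormedAddCommGroup X] [InnerProductSpace ℝ X],
      Bastiani.IsDistanceLike k (fun Z : X => ‖Z‖)) := by
  refine ⟨?_, fun X _ _ => Bastiani.isDistanceLike_norm k X⟩
  intro P _ _ _ _ _ _ _ E _ _ _ _ _ _ _ F _ _ _ _ _ _ _ V V' hV τ hτ _ ξ hξ
  obtain ⟨a, ha⟩ := Bastiani.exists_seeley_coeff
  have hB := hξ.isPair_prod hV
  have hU := Bastiani.IsPair.univ_prod (P := P) hV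
  -- Halving gives `e^c < 1 + τ`, so `T` lies in the open set `ξ > e^c`, where the extension
  -- vanishes.
  have hc : 0 < Real.log (1 + τ) / 2 := half_pos (Real.log_pos (by linarith))
  have hcτ : Real.exp (Real.log (1 + τ) / 2) < 1 + τ := by
    rw [← Real.lt_log_iff_exp_lt (by linarith)]
    linarith
  set c := Real.log (1 + τ) / 2
  refine ⟨{ toFun := fun f => ⟨fun p => Bastiani.ballExt a c ξ (Bastiani.extFun f) p,
              hξ.memCkExt_ballExt ha hc hV fun n hn => Bastiani.tCk_extFun f hB.subset hn⟩
            map_add' := fun f g => Subtype.ext (funext fun p => ?_)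
            map_smul' := fun r f => Subtype.ext (funext fun p => ?_) }, fun f ℓ hℓ => ⟨?_, ?_⟩⟩
  · have h : Bastiani.extFun (f + g) = fun x => Bastiani.extFun f x + Bastiani.extFun g x :=
      funext (Bastiani.extFun_add f g hB.subset hB.subset_closure)
    simp only [h]
    exact Bastiani.ballExt_add hc _ _ _
  · have h : Bastiani.extFun (r • f) = fun x => r • Bastiani.extFun f x :=
      funext (Bastiani.extFun_smul r f hB.subset hB.subset_closure)
    simp only [h]
    exact Bastiani.ballExt_smul hc _ _ _
  · intro Z x hZ hx w
    refine Bastiani.extDifferential_congr _ f hU.subset hB.subset hB.isOpen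
      (prod_mono_left (subset_univ _)) subset_rfl ?_ hℓ _ _ (hB.subset_closure ⟨hZ, hx⟩) w
    intro p hp
    have hp' : p ∈ (univ : Set P) ×ˢ V := ⟨mem_univ _, hp.2⟩
    rw [Bastiani.zeroExt_of_mem _ hp, Bastiani.zeroExt_of_mem _ hp']
    exact (Bastiani.ballExt_of_lt _ hp.1.2).trans (Bastiani.extFun_eq f hB.subset hp)
  · intro Z x hZ hx w
    have hO : IsOpen ((ξ ⁻¹' Ioi (Real.exp c)) ×ˢ V) :=
      (isOpen_Ioi.preimage hξ.continuous).prod hV.isOpen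
    have hmem : (Z, x) ∈ closure ((ξ ⁻¹' Ioi (Real.exp c)) ×ˢ V) := by
      rw [closure_prod_eq]
      exact ⟨subset_closure (hcτ.trans_le hZ), hV.subset_closure hx⟩
    refine (Bastiani.extDifferential_congr (hU₁ := hU.isOpen) _ 0 hU.subset hU.subset hO
      (prod_mono_left (subset_univ _)) (prod_mono_left (subset_univ _)) ?_ hℓ _ ⟨mem_univ Z, hx⟩
      hmem w).trans (Bastiani.extDifferential_zero hU.subset hU.subset_closure hℓ _ w)
    intro p hp
    have hp' : p ∈ (univ : Set P) ×ˢ V := ⟨mem_univ _, hp.2⟩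
    rw [Bastiani.zeroExt_of_mem _ hp', Bastiani.zeroExt_of_mem _ hp']
    exact Bastiani.ballExt_of_exp_lt hc _ hp.1
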